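/- Let $k$ be a field. For a finite quiver $Q$ let $kQ$ be its path algebra, with the convention under which right $kQ$-modules are the representations of $Q$; write $e_v\in kQ$ for the idempotent of a vertex $v$. For a set $\Sigma$ of maps between finitely generated projective right $A$-modules, the universal localisation $A\to A_\Sigma$ is the universal ring homomorphism $A\to B$ such that $\sigma\otimes_A B$ is an isomorphism for all $\sigma\in\Sigma$. Let $Q_1,Q_2$ be finite acyclic quivers and, for $i=1,2$, let $\Sigma_i$ be a set of maps between finitely generated projective $kQ_i$-modules and $f_i\colon kQ_i\to M_{m_i}(k\langle x_1,\dots,x_{n_i}\rangle)$ a $k$-algebra homomorphism with $m_i\ge 1$, $n_i\ge 0$, which is the universal localisation of $kQ_i$ at $\Sigma_i$. For a vertex $v$ of $Q_i$ let $\alpha_i(v)$ be the rank of the free $k\langle x_1,\dots,x_{n_i}\rangle$-module that is the image of the idempotent matrix $f_i(e_v)$. Let $Q$ be a quiver obtained from the disjoint union of $Q_1$ and $Q_2$ by adding arrows, each of which goes from a vertex of $Q_1$ to a vertex of $Q_2$ or from a vertex of $Q_2$ to a vertex of $Q_1$. Let $\Sigma$ be the set of the maps $\sigma\otimes_{kQ_i}kQ$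 between finitely generated projective $kQ$-modules, for $\sigma\in\Sigma_i$ and $i=1,2$, induced along the (non-unital) inclusions $kQ_i\subseteq kQ$ (explicitly, $P\otimes_{kQ_i}kQ$ means $P\otimes_{kQ_i}\varepsilon_i kQ$, with $\varepsilon_i$ the sum of the $e_v$ over the vertices $v$ of $Q_i$). Let $kQ\to kQ_\Sigma$ be the universal localisation at $\Sigma$. Let $Q'$ be the quiver with two vertices $v_1,v_2$ and the following arrows: $n_1$ loops at $v_1$; $n_2$ loops at $v_2$; for each added arrow $e$ of $Q$ from a vertex $s(e)$ of $Q_1$ to a vertex $t(e)$ of $Q_2$, $\alpha_1(s(e))\,\alpha_2(t(e))$ arrows from $v_1$ to $v_2$; and for each added arrow $e$ from a vertex $s(e)$ of $Q_2$ to a vertex $t(e)$ of $Q_1$, $\alpha_2(s(e))\,\alpha_1(t(e))$ arrows from $v_2$ to $v_1$. Then the category of all $kQ_\Sigma$-modules is $k$-linearly equivalent to the category of all (not necessarily finite-dimensional) representations of $Q'$ over $k$. -/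

import Mathlib

open CategoryTheory
open scoped TensorProduct

universe u

noncomputable section

/-! ### Path algebras

Paths are multiplied like functions: `p * q` is the path "first `q`, then `p`" if the target of `q`
is the source of `p`, and `0` otherwise.  With this convention the left modules over the path
algebra are the covariant representations of the quiver; they are the right modules over the path
algebra in which paths are multiplied in the opposite order. -/

/-- The path algebra `kQ` of a quiver `Q` with vertex type `V`: the `k`-vector space with basis all
paths of `Q` (a path is stored as its source, its target and the path itself). -/
def PathAlgebra (k V : Type u) [Field k] [Quiver.{u} V] : Type u :=
  (Σ a b : V, Quiver.Path a b) →₀ k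

namespace PathAlgebra

variable {k V W : Type u} [Field k] [Quiver.{u} V] [Quiver.{u} W]

instance : AddCommGroup (PathAlgebra k V) :=
  inferInstanceAs (AddCommGroup ((Σ a b : V, Quiver.Path a b) →₀ k))

instance : Module k (PathAlgebra k V) :=
  inferInstanceAs (Module k ((Σ a b : V, Quiver.Path a b) →₀ k))

/-- The basis element of the path algebra given by a path. -/
def ofPath {a b : V} (p : Quiver.Path a b) : PathAlgebra k V :=
  Finsupp.single (⟨a, b, p⟩ : Σ a b : V, Quiver.Path a b) (1 : k)

/-- The linear map out of the path algebra with prescribed values on paths. -/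
def linLift {M : Type*} [AddCommGroup M] [Module k M]
    (F : (Σ a b : V, Quiver.Path a b) → M) : PathAlgebra k V →ₗ[k] M :=
  Finsupp.linearCombination k F

@[simp] theorem linLift_ofPath {M : Type*} [AddCommGroup M] [Module k M]
    (F : (Σ a b : V, Quiver.Path a b) → M) {a b : V} (p : Quiver.Path a b) :
    linLift F (ofPath p : PathAlgebra k V) = F ⟨a, b, p⟩ :=
  (Finsupp.linearCombination_single k (1 : k) _).trans (one_smul k _)

theorem induction_ofPath {P : PathAlgebra k V → Prop} (x : PathAlgebra k V) (h0 : P 0)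
    (hadd : ∀ y z, P y → P z → P (y + z))
    (hpath : ∀ (c : k) (a b : V) (p : Quiver.Path a b), P (c • ofPath p)) : P x := by
  refine Finsupp.induction_linear (motive := P) x h0 hadd fun ⟨a, b, p⟩ c => ?_
  have h := hpath c a b p
  have e : c • (ofPath p : PathAlgebra k V)
      = Finsupp.single (⟨a, b, p⟩ : Σ a b : V, Quiver.Path a b) c :=
    (Finsupp.smul_single c _ _).trans (by rw [smul_eq_mul, mul_one])
  exact e ▸ h

open Classical in
/-- The product of two paths in the path algebra. -/
def pathMul (x y : Σ a b : V, Quiver.Path a b) : PathAlgebra k V :=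
  if h : y.2.1 = x.1 then ofPath ((y.2.2.cast rfl h).comp x.2.2) else 0

theorem pathMul_comp {a b c : V} (p : Quiver.Path b c) (q : Quiver.Path a b) :
    pathMul ⟨b, c, p⟩ ⟨a, b, q⟩ = (ofPath (q.comp p) : PathAlgebra k V) := by
  simp [pathMul]

theorem pathMul_ne {a b c d : V} (p : Quiver.Path c d) (q : Quiver.Path a b) (h : b ≠ c) :
    pathMul ⟨c, d, p⟩ ⟨a, b, q⟩ = (0 : PathAlgebra k V) := by
  simp [pathMul, h]

/-- The bilinear multiplication of the path algebra. -/
def mulLin : PathAlgebra k V →ₗ[k] PathAlgebra k V →ₗ[k] PathAlgebra k V :=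
  linLift fun x => linLift fun y => pathMul x y

instance : Mul (PathAlgebra k V) := ⟨fun x y => mulLin x y⟩

theorem mul_def (x y : PathAlgebra k V) : x * y = mulLin x y := rfl

theorem ofPath_mul_ofPath {a b c : V} (p : Quiver.Path b c) (q : Quiver.Path a b) :
    (ofPath p * ofPath q : PathAlgebra k V) = ofPath (q.comp p) := by
  simp [mul_def, mulLin, pathMul_comp]

theorem ofPath_mul_ofPath_of_ne {a b c d : V} (p : Quiver.Path c d) (q : Quiver.Path a b)
    (h : b ≠ c) : (ofPath p * ofPath q : PathAlgebra k V) = 0 := by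
  simp [mul_def, mulLin, pathMul_ne p q h]

instance : NonUnitalRing (PathAlgebra k V) where
  left_distrib x y z := by simp [mul_def]
  right_distrib x y z := by simp [mul_def]
  zero_mul x := by simp [mul_def]
  mul_zero x := by simp [mul_def]
  mul_assoc := by
    have key : ∀ {a b c d e f : V} (p : Quiver.Path a b) (q : Quiver.Path c d)
        (r : Quiver.Path e f), (ofPath p * ofPath q * ofPath r : PathAlgebra k V)
          = ofPath p * (ofPath q * ofPath r) := by
      intro a b c d e f p q r
      by_cases h₁ : d = a
      · subst h₁
        by_cases h₂ : f = c
        · subst h₂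
          simp only [ofPath_mul_ofPath, Quiver.Path.comp_assoc]
        · rw [ofPath_mul_ofPath, ofPath_mul_ofPath_of_ne _ _ h₂, ofPath_mul_ofPath_of_ne _ _ h₂]
          simp [mul_def]
      · rw [ofPath_mul_ofPath_of_ne _ _ h₁]
        by_cases h₂ : f = c
        · subst h₂
          rw [ofPath_mul_ofPath, ofPath_mul_ofPath_of_ne _ _ h₁]
          simp [mul_def]
        · rw [ofPath_mul_ofPath_of_ne _ _ h₂]
          simp [mul_def]
    have hs : ∀ (c : k) (x y : PathAlgebra k V), (c • x) * y = c • (x * y) := by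
      intro c x y; simp [mul_def]
    have hs' : ∀ (c : k) (x y : PathAlgebra k V), x * (c • y) = c • (x * y) := by
      intro c x y; simp [mul_def]
    have ha : ∀ x y z : PathAlgebra k V, (x + y) * z = x * z + y * z := by
      intro x y z; simp [mul_def]
    have ha' : ∀ x y z : PathAlgebra k V, x * (y + z) = x * y + x * z := by
      intro x y z; simp [mul_def]
    have h0 : ∀ x : PathAlgebra k V, 0 * x = 0 := by
      intro x; simp [mul_def]
    have h0' : ∀ x : PathAlgebra k V, x * 0 = 0 := by
      intro x; simp [mul_def]
    intro x y z
    refine induction_ofPath (P := fun x => x * y * z = x * (y * z)) x (by simp only [h0])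
      (fun u v hu hv => by simp only [ha, hu, hv]) ?_
    intro r a b p
    refine induction_ofPath (P := fun y => r • ofPath p * y * z = r • ofPath p * (y * z)) y
      (by simp only [h0, h0'])
      (fun u v hu hv => by simp only [ha, ha', hu, hv]) ?_
    intro s c d q
    refine induction_ofPath
      (P := fun z => r • ofPath p * s • ofPath q * z = r • ofPath p * (s • ofPath q * z)) z
      (by simp only [h0'])
      (fun u v hu hv => by simp only [ha', hu, hv]) ?_
    intro t e f w
    simp only [hs, hs', key]

instance : IsScalarTower k (PathAlgebra k V) (PathAlgebra k V) :=
  ⟨fun c x y => by simp [mul_def, smul_eq_mul]⟩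

instance : SMulCommClass k (PathAlgebra k V) (PathAlgebra k V) :=
  ⟨fun c x y => by simp [mul_def, smul_eq_mul]⟩

/-- The idempotent of the path algebra given by the path of length zero at a vertex. -/
def vertex (v : V) : PathAlgebra k V := ofPath (Quiver.Path.nil : Quiver.Path v v)

instance [Fintype V] : One (PathAlgebra k V) := ⟨∑ v, vertex v⟩

theorem one_def [Fintype V] : (1 : PathAlgebra k V) = ∑ v, vertex v := rfl

instance [Fintype V] : Ring (PathAlgebra k V) :=
  { (inferInstance : NonUnitalRing (PathAlgebra k V)) with
    one := 1
    one_mul := by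
      intro x
      refine induction_ofPath (P := fun x => 1 * x = x) x (mul_zero _)
        (fun u v hu hv => by rw [mul_add, hu, hv]) fun c a b p => ?_
      rw [mul_smul_comm, one_def, Finset.sum_mul, Finset.sum_eq_single b]
      · rw [vertex, ofPath_mul_ofPath, Quiver.Path.comp_nil]
      · intro v _ hv
        exact ofPath_mul_ofPath_of_ne _ _ hv.symm
      · intro h
        exact absurd (Finset.mem_univ b) h
    mul_one := by
      intro x
      refine induction_ofPath (P := fun x => x * 1 = x) x (zero_mul _)
        (fun u v hu hv => by rw [add_mul, hu, hv]) fun c a b p => ?_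
      rw [smul_mul_assoc, one_def, Finset.mul_sum, Finset.sum_eq_single a]
      · rw [vertex, ofPath_mul_ofPath, Quiver.Path.nil_comp]
      · intro v _ hv
        exact ofPath_mul_ofPath_of_ne _ _ hv
      · intro h
        exact absurd (Finset.mem_univ a) h }

instance [Fintype V] : Algebra k (PathAlgebra k V) :=
  Algebra.ofModule smul_mul_assoc mul_smul_comm

/-- The (in general non-unital) ring homomorphism between path algebras induced by a morphism of
quivers that is injective on vertices. -/
def map (F : V ⥤q W) (hF : Function.Injective F.obj) : PathAlgebra k V →ₙ+* PathAlgebra k W where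
  toFun := linLift fun x => ofPath (F.mapPath x.2.2)
  map_zero' := map_zero _
  map_add' := map_add _
  map_mul' x y := by
    change linLift _ (x * y) = linLift _ x * linLift _ y
    refine induction_ofPath (P := fun x => linLift _ (x * y) = linLift _ x * linLift _ y) x
      (by simp only [zero_mul, map_zero])
      (fun u v hu hv => by simp only [add_mul, map_add, hu, hv]) fun r c d p => ?_
    refine induction_ofPath
      (P := fun y => linLift _ (r • ofPath p * y) = linLift _ (r • ofPath p) * linLift _ y) y
      (by simp only [mul_zero, map_zero])
      (fun u v hu hv => by simp only [mul_add, map_add, hu, hv]) fun s a b q => ?_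
    simp only [smul_mul_assoc, mul_smul_comm, map_smul, linLift_ofPath]
    by_cases h : b = c
    · subst h
      simp only [ofPath_mul_ofPath, linLift_ofPath, Prefunctor.mapPath_comp]
    · rw [ofPath_mul_ofPath_of_ne _ _ h, ofPath_mul_ofPath_of_ne _ _ (fun e => h (hF e)), map_zero]

theorem map_ofPath (F : V ⥤q W) (hF : Function.Injective F.obj) {a b : V} (p : Quiver.Path a b) :
    map F hF (ofPath p : PathAlgebra k V) = ofPath (F.mapPath p) :=
  linLift_ofPath _ p

end PathAlgebra

/-- A quiver is acyclic if every path from a vertex to itself has length zero. -/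
def QuiverAcyclic (V : Type u) [Quiver.{u} V] : Prop :=
  ∀ (v : V) (p : Quiver.Path v v), p.length = 0

/-! ### Universal localisation

Maps between (left) modules over a ring are recorded as arrows of the category of modules. -/

section Localisation

variable {A B : Type u} [Ring A] [Ring B]

/-- The relations `b f(a) ⊗ p = b ⊗ a p` in `B ⊗_ℤ P`. -/
def inducedRel (f : A →ₙ+* B) (P : Type u) [AddCommGroup P] [Module A P] :
    Submodule B (B ⊗[ℤ] P) :=
  Submodule.span B {z | ∃ (b : B) (a : A) (p : P), z = (b * f a) ⊗ₜ[ℤ] p - b ⊗ₜ[ℤ] (a • p)}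

/-- The induced `B`-module `B ⊗_A P` of a left `A`-module `P` along a ring homomorphism
`f : A → B`.  If `f` does not preserve the unit, this is `B f(1) ⊗_A P`. -/
abbrev Induced (f : A →ₙ+* B) (P : Type u) [AddCommGroup P] [Module A P] : Type u :=
  (B ⊗[ℤ] P) ⧸ inducedRel f P

/-- The `B`-linear map `B ⊗_A σ : B ⊗_A P → B ⊗_A Q` induced by an `A`-linear map `σ : P → Q`. -/
def inducedMap (f : A →ₙ+* B) {P Q : Type u} [AddCommGroup P] [Module A P] [AddCommGroup Q]
    [Module A Q] (σ : P →ₗ[A] Q) : Induced f P →ₗ[B] Induced f Q :=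
  Submodule.mapQ (inducedRel f P) (inducedRel f Q)
    (TensorProduct.AlgebraTensorModule.map (LinearMap.id : B →ₗ[B] B) (σ.toAddMonoidHom.toIntLinearMap))
    (by
      refine Submodule.span_le.2 ?_
      rintro _ ⟨b, a, p, rfl⟩
      refine Submodule.subset_span ⟨b, a, σ p, ?_⟩
      simp)

/-- The set of maps `B ⊗_A σ` for `σ` in a set `S` of maps of left `A`-modules. -/
def inducedSet (f : A →ₙ+* B) (S : Set (Arrow (ModuleCat.{u} A))) :
    Set (Arrow (ModuleCat.{u} B)) :=
  (fun σ => Arrow.mk (ModuleCat.ofHom (inducedMap f σ.hom.hom))) '' S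

/-- The members of `S` are maps between finitely generated projective modules. -/
def BetweenFGProjectives (S : Set (Arrow (ModuleCat.{u} A))) : Prop :=
  ∀ σ ∈ S, (Module.Finite A σ.left ∧ Module.Projective A σ.left) ∧
    (Module.Finite A σ.right ∧ Module.Projective A σ.right)

/-- The ring homomorphism `f : A → B` is `S`-inverting: `B ⊗_A σ` is an isomorphism of
`B`-modules for every `σ` in `S`. -/
def IsInverting (S : Set (Arrow (ModuleCat.{u} A))) (f : A →+* B) : Prop :=
  ∀ σ ∈ S, Function.Bijective (inducedMap (f : A →ₙ+* B) σ.hom.hom)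

/-- The ring homomorphism `f : A → B` is the universal localisation of `A` at `S`: it is
`S`-inverting, and every `S`-inverting ring homomorphism factors uniquely through it. -/
def IsUniversalLocalisation (S : Set (Arrow (ModuleCat.{u} A))) (f : A →+* B) : Prop :=
  IsInverting S f ∧
    ∀ (C : Type u) [Ring C] (g : A →+* C), IsInverting S g → ∃! h : B →+* C, h.comp f = g

end Localisation

/-! ### Homomorphisms to matrix rings and their dimension vectors -/

/-- The matrix ring `M_m(k⟨x_1, …, x_n⟩)`. -/
abbrev FreeMatrix (k : Type u) [Field k] (m n : ℕ) : Type u :=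
  Matrix (Fin m) (Fin m) (FreeAlgebra k (Fin n))

/-- The rank of a finitely generated free module `P`: the number `r` with `P ≅ R^r`.
(`Module.finrank` is defined through linearly independent families; over `k⟨x, y⟩` it is `0` for
every nonzero free module, as `k⟨x, y⟩` has infinite linearly independent families.) -/
def freeRank (R P : Type u) [Ring R] [AddCommGroup P] [Module R P] : ℕ :=
  sInf {r : ℕ | Nonempty (P ≃ₗ[R] (Fin r → R))}

/-- The dimension vector `α` of a homomorphism `f : kQ → M_m(k⟨x_1, …, x_n⟩)`: the number `α v` is
the rank of the free `k⟨x_1, …, x_n⟩`-module that is the image of the idempotent matrix `f(e_v)`,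
acting on row vectors. -/
def dimVector {k V : Type u} [Field k] [Quiver.{u} V] [Fintype V] {m n : ℕ}
    (f : PathAlgebra k V →ₐ[k] FreeMatrix k m n) (v : V) : ℕ :=
  freeRank (FreeAlgebra k (Fin n))
    (LinearMap.range (Matrix.vecMulLinear (f (PathAlgebra.vertex v))))

/-! ### Joining two quivers, and the quiver with two vertices -/

/-- The arrows of the quiver obtained from the disjoint union of quivers with vertex types `V₁`
and `V₂` by adding a set `E₁₂ a b` of arrows from each `a : V₁` to each `b : V₂`, and a set
`E₂₁ b a` of arrows from each `b : V₂` to each `a : V₁`. -/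
inductive JoinArrow {V₁ V₂ : Type u} [Quiver.{u} V₁] [Quiver.{u} V₂] (E₁₂ : V₁ → V₂ → Type u)
    (E₂₁ : V₂ → V₁ → Type u) : V₁ ⊕ V₂ → V₁ ⊕ V₂ → Type u
  | old₁ {a b : V₁} (e : a ⟶ b) : JoinArrow E₁₂ E₂₁ (Sum.inl a) (Sum.inl b)
  | old₂ {a b : V₂} (e : a ⟶ b) : JoinArrow E₁₂ E₂₁ (Sum.inr a) (Sum.inr b)
  | new₁₂ {a : V₁} {b : V₂} (e : E₁₂ a b) : JoinArrow E₁₂ E₂₁ (Sum.inl a) (Sum.inr b)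
  | new₂₁ {b : V₂} {a : V₁} (e : E₂₁ b a) : JoinArrow E₁₂ E₂₁ (Sum.inr b) (Sum.inl a)

/-- The vertices of the joined quiver. -/
def JoinQuiver {V₁ V₂ : Type u} (_E₁₂ : V₁ → V₂ → Type u) (_E₂₁ : V₂ → V₁ → Type u) : Type u :=
  V₁ ⊕ V₂

namespace JoinQuiver

variable {V₁ V₂ : Type u} [Quiver.{u} V₁] [Quiver.{u} V₂] (E₁₂ : V₁ → V₂ → Type u)
  (E₂₁ : V₂ → V₁ → Type u)

instance : Quiver.{u} (JoinQuiver E₁₂ E₂₁) := ⟨JoinArrow E₁₂ E₂₁⟩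

instance [Fintype V₁] [Fintype V₂] : Fintype (JoinQuiver E₁₂ E₂₁) :=
  inferInstanceAs (Fintype (V₁ ⊕ V₂))

/-- The inclusion of the first quiver. -/
def incl₁ : V₁ ⥤q JoinQuiver E₁₂ E₂₁ where
  obj := Sum.inl
  map e := JoinArrow.old₁ e

/-- The inclusion of the second quiver. -/
def incl₂ : V₂ ⥤q JoinQuiver E₁₂ E₂₁ where
  obj := Sum.inr
  map e := JoinArrow.old₂ e

/-- The set of maps of modules over the path algebra of the joined quiver that correspond to the
maps in `S₁` and in `S₂`. -/
def joinedSet {k : Type u} [Field k] [Fintype V₁] [Fintype V₂]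
    (S₁ : Set (Arrow (ModuleCat.{u} (PathAlgebra k V₁))))
    (S₂ : Set (Arrow (ModuleCat.{u} (PathAlgebra k V₂)))) :
    Set (Arrow (ModuleCat.{u} (PathAlgebra k (JoinQuiver E₁₂ E₂₁)))) :=
  inducedSet (PathAlgebra.map (incl₁ E₁₂ E₂₁) Sum.inl_injective) S₁ ∪
    inducedSet (PathAlgebra.map (incl₂ E₁₂ E₂₁) Sum.inr_injective) S₂

end JoinQuiver

/-- The two vertices of the two-vertex quiver. -/
inductive TwoVertex : Type
  | v₁
  | v₂

/-- The arrows of the quiver with two vertices: `n₁` loops at `v₁`, `n₂` loops at `v₂`,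
`α₁ a * α₂ b` arrows from `v₁` to `v₂` for each arrow in `E₁₂ a b`, and `α₂ b * α₁ a` arrows from
`v₂` to `v₁` for each arrow in `E₂₁ b a`. -/
inductive TwoVertexArrow {V₁ V₂ : Type u} (E₁₂ : V₁ → V₂ → Type u) (E₂₁ : V₂ → V₁ → Type u)
    (n₁ n₂ : ℕ) (α₁ : V₁ → ℕ) (α₂ : V₂ → ℕ) : TwoVertex → TwoVertex → Type u
  | loop₁ (i : Fin n₁) : TwoVertexArrow E₁₂ E₂₁ n₁ n₂ α₁ α₂ .v₁ .v₁
  | loop₂ (i : Fin n₂) : TwoVertexArrow E₁₂ E₂₁ n₁ n₂ α₁ α₂ .v₂ .v₂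
  | arrow₁₂ (a : V₁) (b : V₂) (e : E₁₂ a b) (i : Fin (α₁ a)) (j : Fin (α₂ b)) :
      TwoVertexArrow E₁₂ E₂₁ n₁ n₂ α₁ α₂ .v₁ .v₂
  | arrow₂₁ (b : V₂) (a : V₁) (e : E₂₁ b a) (j : Fin (α₂ b)) (i : Fin (α₁ a)) :
      TwoVertexArrow E₁₂ E₂₁ n₁ n₂ α₁ α₂ .v₂ .v₁

/-- The quiver `Q'` with two vertices. -/
def TwoVertexQuiver {V₁ V₂ : Type u} (_E₁₂ : V₁ → V₂ → Type u) (_E₂₁ : V₂ → V₁ → Type u)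
    (_n₁ _n₂ : ℕ) (_α₁ : V₁ → ℕ) (_α₂ : V₂ → ℕ) : Type :=
  TwoVertex

instance {V₁ V₂ : Type u} (E₁₂ : V₁ → V₂ → Type u) (E₂₁ : V₂ → V₁ → Type u)
    (n₁ n₂ : ℕ) (α₁ : V₁ → ℕ) (α₂ : V₂ → ℕ) :
    Quiver.{u} (TwoVertexQuiver E₁₂ E₂₁ n₁ n₂ α₁ α₂) :=
  ⟨TwoVertexArrow E₁₂ E₂₁ n₁ n₂ α₁ α₂⟩

/-- The category of representations of a quiver over a field `k`: a vector space for every vertex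
and a linear map for every arrow, that is, a functor from the path category; morphisms are the
natural transformations. -/
abbrev QuiverRep (k : Type u) [Field k] (V : Type*) [Quiver.{u} V] :=
  Paths V ⥤ ModuleCat.{u} k

end

/-!
Write `M₁` and `M₂` for the two matrix rings over free algebras and `B` for the localisation of
the path algebra of the joined quiver.

*Universal property of `B`.* A homomorphism from the joined path algebra to a ring `C` inverts the
joined set of maps if and only if its restrictions to the two smaller path algebras, which do not
preserve the unit, invert `S₁` and `S₂`. The universal property of a localisation extends to such
homomorphisms, as they take values in a corner ring `e C e`
(`IsUniversalLocalisation.exists_comp_eq` and `IsUniversalLocalisation.nonUnital_hom_ext`). So `B`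
is universal among the algebras `C` with orthogonal homomorphisms `h₁ : M₁ → C` and `h₂ : M₂ → C`,
`h₁ 1 + h₂ 1 = 1`, and an element of `h₂ (f₂ e_b) C h₁ (f₁ e_a)` for each added arrow from `a` to
`b`, and likewise in the other direction (`GluedHom.exists_lift`, `GluedHom.exists_of_added`). In
particular `B` is generated by the images of `M₁`, `M₂` and the added arrows
(`GluedHom.subalgebra_eq_top`).

*Rank factorizations.* By the weak algorithm, finitely generated submodules of free modules over a
free algebra are free (`FreeAlgebra.exists_linearEquiv_of_fg`). So the idempotent matrix `f₁ e_a`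
factors through a free module of rank `α₁ a`. Inside the matrix ring this is a pair of dual
families `γ`, `δ` of `α₁ a` matrices with `∑ i, γ i * δ i = f₁ e_a`, and with `δ i * γ j` equal to
a fixed idempotent matrix unit for `i = j` and to `0` otherwise (`DualFamilies`). Therefore an
element of `h₂ (f₂ e_b) C h₁ (f₁ e_a)` amounts to a family of `α₁ a * α₂ b` elements of the Peirce
component between the two idempotent matrix units: its coefficients with respect to the dual
families.

*The equivalence.* Choose an idempotent matrix unit in each of `M₁` and `M₂`. Their images `e₁`,
`e₂` in `B` are the idempotents for the two vertices of `Q'`. The matrix units times the variables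
of the free algebras give the elements of `B` for the loops, and the coefficients of the added
arrows those for the other arrows. A `B`-module `N` is sent to the representation `(e₁ N, e₂ N)`,
which is an instance of `PeirceData.repFunctor`. The matrix units in the columns and rows of
the chosen ones give a partition of unity `1 = ∑ j, c j * d j` that factors through `e₁` and `e₂`,
which makes the functor faithful.
It is full because all coefficients `d j * b * c l` of elements `b` of `B` are combinations of
products along paths of `Q'`; it suffices to see this for the generators (`GluedHom.gen_coeff`).
It is essentially surjective because a representation `(L₁, L₂)` provides actions of `M₁` and `M₂`
on `L₁ ^ m₁ × L₂ ^ m₂` and, through the dual families, of the added arrows, hence by universality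
an action of `B` (`GluedHom.exists_of_rep`).
-/

noncomputable section

/-! ### Weak algorithm and freeness over free algebras -/

namespace FreeAlgebra

variable {k X : Type*} [Field k]

open Classical in
/-- The algebra homomorphism `a ↦ !![ε(a), δ_x(a); 0, a]`, which packages the augmentation `ε` and
the left cofactor `δ_x` of a letter `x`; its multiplicativity is the product rule for `δ_x`. -/
def cofactorHom (x : X) : FreeAlgebra k X →ₐ[k] Matrix (Fin 2) (Fin 2) (FreeAlgebra k X) :=
  lift k fun y => !![0, if y = x then 1 else 0; 0, ι k y]

/-- The left cofactor `δ_x(a)` of the letter `x` in `a`: the sum of all `w` such that `x w` is a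
monomial of `a`, with the coefficients of `a`. -/
def cofactor (x : X) : FreeAlgebra k X →ₗ[k] FreeAlgebra k X where
  toFun a := cofactorHom x a 0 1
  map_add' a b := by simp
  map_smul' c a := by simp

theorem cofactorHom_apply (x : X) (a : FreeAlgebra k X) :
    cofactorHom x a = !![algebraMap k _ (algebraMapInv a), cofactor x a; 0, a] := by
  have h : cofactorHom x a 0 0 = algebraMap k _ (algebraMapInv a) ∧ cofactorHom x a 1 0 = 0 ∧
      cofactorHom x a 1 1 = a := by
    induction a using FreeAlgebra.induction with
    | grade0 r => simp [Matrix.algebraMap_matrix_apply, algebraMapInv]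
    | grade1 y => simp [cofactorHom, algebraMapInv]
    | mul a b ha hb => simp [Matrix.mul_apply, Fin.sum_univ_two, ha, hb]
    | add a b ha hb => simp [ha, hb]
  ext i j
  fin_cases i <;> fin_cases j
  · exact h.1
  · rfl
  · exact h.2.1
  · exact h.2.2

theorem cofactor_mul (x : X) (a b : FreeAlgebra k X) :
    cofactor x (a * b) = cofactor x a * b + algebraMapInv a • cofactor x b := by
  have h : cofactor x (a * b) = (cofactorHom x a * cofactorHom x b) 0 1 := by
    rw [← map_mul]; rfl
  rw [h, cofactorHom_apply, cofactorHom_apply]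
  simp [Matrix.mul_apply, Fin.sum_univ_two, Algebra.smul_def, add_comm]

@[simp] theorem cofactor_algebraMap (x : X) (r : k) :
    cofactor x (algebraMap k (FreeAlgebra k X) r) = 0 := by
  simp [cofactor, Matrix.algebraMap_matrix_apply]

open Classical in
theorem cofactor_ι (x y : X) : cofactor x (ι k y) = if y = x then 1 else 0 := by
  simp [cofactor, cofactorHom]

theorem eq_algebraMap_of_cofactor_eq_zero [Fintype X] (a : FreeAlgebra k X)
    (h : ∀ x, cofactor x a = 0) : a = algebraMap k _ (algebraMapInv a) := by
  have key : ∀ a : FreeAlgebra k X,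
      a = algebraMap k _ (algebraMapInv a) + ∑ x, ι k x * cofactor x a := by
    intro a
    induction a using FreeAlgebra.induction with
    | grade0 r => simp [algebraMapInv]
    | grade1 y => classical simp [cofactor_ι, algebraMapInv]
    | add a b ha hb =>
      conv_lhs => rw [ha, hb]
      simp only [map_add, mul_add, Finset.sum_add_distrib]
      abel
    | mul a b ha hb =>
      have h1 : a * b = algebraMap k _ (algebraMapInv a) * b + ∑ x, ι k x * (cofactor x a * b) := by
        conv_lhs => rw [ha]
        simp only [add_mul, Finset.sum_mul, mul_assoc]
      have h2 : algebraMap k (FreeAlgebra k X) (algebraMapInv a) * b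
          = algebraMap k _ (algebraMapInv (a * b))
            + ∑ x, ι k x * (algebraMapInv a • cofactor x b) := by
        conv_lhs => rw [hb]
        simp only [mul_add, map_mul, Finset.mul_sum, Algebra.smul_def]
        congr 1
        refine Finset.sum_congr rfl fun x _ => ?_
        rw [← mul_assoc, Algebra.commutes, mul_assoc]
      refine h1.trans ?_
      rw [h2, add_assoc, ← Finset.sum_add_distrib]
      refine congrArg _ ?_
      refine Finset.sum_congr rfl fun x _ => ?_
      rw [cofactor_mul, mul_add, add_comm]
  conv_lhs => rw [key a]
  simp [h]

variable (k X) in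
/-- The elements of degree less than `N` in the free algebra, by recursion on `N`: an element has
degree less than `N + 1` if all its left cofactors have degree less than `N`. -/
def degLT : ℕ → Submodule k (FreeAlgebra k X)
  | 0 => ⊥
  | N + 1 => ⨅ x, (degLT N).comap (cofactor x)

@[simp] theorem mem_degLT_zero {a : FreeAlgebra k X} : a ∈ degLT k X 0 ↔ a = 0 := Iff.rfl

theorem mem_degLT_succ {N : ℕ} {a : FreeAlgebra k X} :
    a ∈ degLT k X (N + 1) ↔ ∀ x, cofactor x a ∈ degLT k X N := by
  simp [degLT]

theorem degLT_mono : Monotone (degLT k X) := by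
  refine monotone_nat_of_le_succ fun N => ?_
  induction N with
  | zero => exact bot_le
  | succ N ih => exact fun a ha => mem_degLT_succ.2 fun x => ih (mem_degLT_succ.1 ha x)

theorem cofactor_mem_degLT {N : ℕ} {a : FreeAlgebra k X} (ha : a ∈ degLT k X N) (x : X) :
    cofactor x a ∈ degLT k X (N - 1) := by
  cases N with
  | zero => rw [mem_degLT_zero.1 ha, map_zero]; exact zero_mem _
  | succ N => exact mem_degLT_succ.1 ha x

theorem mul_mem_degLT {N M : ℕ} {a b : FreeAlgebra k X} (ha : a ∈ degLT k X N)
    (hb : b ∈ degLT k X M) : a * b ∈ degLT k X (N + M) := by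
  induction N generalizing a with
  | zero => rw [mem_degLT_zero.1 ha, zero_mul]; exact zero_mem _
  | succ N ih =>
    rw [Nat.add_right_comm]
    refine mem_degLT_succ.2 fun x => ?_
    rw [cofactor_mul]
    exact add_mem (ih (mem_degLT_succ.1 ha x))
      (Submodule.smul_mem _ _ (degLT_mono (by omega) (cofactor_mem_degLT hb x)))

theorem exists_mem_degLT (a : FreeAlgebra k X) : ∃ N, a ∈ degLT k X N := by
  classical
  induction a using FreeAlgebra.induction with
  | grade0 r => exact ⟨1, mem_degLT_succ.2 fun x => by simp⟩
  | grade1 y =>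
    refine ⟨2, mem_degLT_succ.2 fun x => mem_degLT_succ.2 fun z => ?_⟩
    rw [cofactor_ι]
    split_ifs
    · simpa using cofactor_algebraMap (k := k) z 1
    · simp
  | add a b ha hb =>
    obtain ⟨N, hN⟩ := ha
    obtain ⟨M, hM⟩ := hb
    exact ⟨max N M, add_mem (degLT_mono (le_max_left _ _) hN) (degLT_mono (le_max_right _ _) hM)⟩
  | mul a b ha hb =>
    obtain ⟨N, hN⟩ := ha
    obtain ⟨M, hM⟩ := hb
    exact ⟨N + M, mul_mem_degLT hN hM⟩

/-- The heart of the weak algorithm.  Let `∑ i, a i • u i` have smaller degree than the term of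
index `i₀`, where `u i` has degree less than `l i`, the term of index `i₀` has maximal degree
bound, and among the terms attaining this bound `l i₀` is maximal.  Stripping the letters of a
leading word of `a i₀` one at a time turns the coefficient of `u i₀` into a nonzero scalar, so
that a combination of the `u i` with coefficient `1` at `i₀` has degree less than that of
`u i₀`. -/
theorem exists_reduction [Fintype X] {I J : Type*} [Fintype I] (u : I → J → FreeAlgebra k X)
    (l : I → ℕ) (hu : ∀ i j, u i j ∈ degLT k X (l i)) (i₀ : I) (hl : 1 ≤ l i₀) (e : ℕ)
    (a : I → FreeAlgebra k X)
    (ha : ∀ i, a i ∈ degLT k X (e + l i₀ + (if l i ≤ l i₀ then 1 else 0) - l i))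
    (ha₀ : a i₀ ∉ degLT k X e)
    (hsum : ∀ j, ∑ i, a i * u i j ∈ degLT k X (e + (l i₀ - 1))) :
    ∃ b : I → FreeAlgebra k X, b i₀ = 1 ∧ ∀ j, ∑ i, b i * u i j ∈ degLT k X (l i₀ - 1) := by
  induction e generalizing a with
  | zero =>
    have h1 : a i₀ ∈ degLT k X 1 := by simpa using ha i₀
    have h2 := eq_algebraMap_of_cofactor_eq_zero (a i₀) (mem_degLT_succ.1 h1)
    have h3 : algebraMapInv (a i₀) ≠ 0 := by
      intro h
      rw [h, map_zero] at h2
      exact ha₀ h2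
    refine ⟨fun i => (algebraMapInv (a i₀))⁻¹ • a i, ?_, fun j => ?_⟩
    · change _ • a i₀ = 1
      rw [Algebra.smul_def]
      refine (congrArg (algebraMap k _ (algebraMapInv (a i₀))⁻¹ * ·) h2).trans ?_
      rw [← map_mul, inv_mul_cancel₀ h3, map_one]
    · simp only [smul_mul_assoc, ← Finset.smul_sum]
      exact Submodule.smul_mem _ _ (by simpa using hsum j)
  | succ e ih =>
    rw [mem_degLT_succ] at ha₀
    push Not at ha₀
    obtain ⟨x, hx⟩ := ha₀
    refine ih (fun i => cofactor x (a i)) (fun i => ?_) hx fun j => ?_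
    · exact degLT_mono (by omega) (cofactor_mem_degLT (ha i) x)
    · have h1 := cofactor_mem_degLT (hsum j) x
      have h2 : ∑ i, algebraMapInv (a i) • cofactor x (u i j) ∈ degLT k X (e + (l i₀ - 1)) := by
        refine sum_mem fun i _ => ?_
        by_cases h0 : a i = 0
        · simp [h0]
        · have h3 : e + 1 + l i₀ + (if l i ≤ l i₀ then 1 else 0) - l i ≠ 0 := by
            intro h
            have := ha i
            rw [h] at this
            exact h0 this
          refine Submodule.smul_mem _ _ (degLT_mono ?_ (cofactor_mem_degLT (hu i j) x))
          split_ifs at h3 <;> omega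
      simp only [map_sum, cofactor_mul, Finset.sum_add_distrib] at h1
      exact (Submodule.add_mem_iff_left _ h2).1 (degLT_mono (by omega) h1)

/-- Weak algorithm: linearly dependent vectors over a free algebra admit a combination, with
coefficient `1` at some index `i₀`, whose degree is less than that of the vector of index `i₀`. -/
theorem exists_reduction_of_not_linearIndependent [Fintype X] {I J : Type*} [Fintype I]
    (u : I → J → FreeAlgebra k X) (l : I → ℕ) (hl : ∀ i, 1 ≤ l i)
    (hu : ∀ i j, u i j ∈ degLT k X (l i)) (h : ¬ LinearIndependent (FreeAlgebra k X) u) :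
    ∃ i₀, ∃ b : I → FreeAlgebra k X, b i₀ = 1 ∧ ∀ j, ∑ i, b i * u i j ∈ degLT k X (l i₀ - 1) := by
  classical
  rw [Fintype.linearIndependent_iff] at h
  push Not at h
  obtain ⟨a, hsum, i, hi⟩ := h
  let o : I → ℕ := fun i => Nat.find (exists_mem_degLT (a i))
  have ho : ∀ i, a i ∈ degLT k X (o i) := fun i => Nat.find_spec (exists_mem_degLT (a i))
  have ho' : ∀ i, a i ≠ 0 → 1 ≤ o i := by
    intro i hi
    by_contra h
    have := ho i
    rw [show o i = 0 by omega] at this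
    exact hi this
  obtain ⟨i₀, hi₀, hmax⟩ := Finset.exists_max_image (Finset.univ.filter fun i => a i ≠ 0)
    (fun i => toLex (o i + l i, l i)) ⟨i, by simpa using hi⟩
  have hi₀ : a i₀ ≠ 0 := by simpa using hi₀
  refine ⟨i₀, exists_reduction u l hu i₀ (hl i₀) (o i₀ - 1) a (fun i => ?_)
    (Nat.find_min (exists_mem_degLT (a i₀)) (Nat.sub_one_lt_of_lt (ho' i₀ hi₀))) fun j => ?_⟩
  · by_cases h0 : a i = 0
    · rw [h0]; exact zero_mem _
    · have h1 := hmax i (by simpa using h0)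
      rw [Prod.Lex.toLex_le_toLex] at h1
      have h2 := ho' i₀ hi₀
      refine degLT_mono ?_ (ho i)
      dsimp only at h1
      split_ifs <;> omega
  · have := congrFun hsum j
    simp only [Finset.sum_apply, Pi.smul_apply, smul_eq_mul, Pi.zero_apply] at this
    rw [this]
    exact zero_mem _

/-- A finite family of vectors over a free algebra spans a free submodule.  The induction is on the
sum of the degree bounds: a zero vector is dropped, and a dependent family is replaced, without
changing its span, by one in which a vector has smaller degree. -/
theorem exists_basis_span_range [Fintype X] {J : Type*} [Finite J] (N : ℕ) (r : ℕ) (l : Fin r → ℕ)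
    (u : Fin r → J → FreeAlgebra k X) (hu : ∀ i j, u i j ∈ degLT k X (l i))
    (hN : ∑ i, (l i + 1) ≤ N) :
    ∃ (s : ℕ) (v : Fin s → J → FreeAlgebra k X), LinearIndependent (FreeAlgebra k X) v ∧
      Submodule.span (FreeAlgebra k X) (Set.range v)
        = Submodule.span (FreeAlgebra k X) (Set.range u) := by
  classical
  induction N generalizing r with
  | zero =>
    have : r = 0 := by
      rw [Finset.sum_add_distrib] at hN
      simp at hN
      omega
    subst this
    exact ⟨0, u, linearIndependent_empty_type, rfl⟩
  | succ N ih =>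
    by_cases hl : ∃ i, l i = 0
    · obtain ⟨i, hi⟩ := hl
      cases r with
      | zero => exact i.elim0
      | succ r =>
        have hui : u i = 0 := by
          funext j
          have := hu i j
          rwa [hi] at this
        obtain ⟨s, v, hv, hs⟩ := ih r (fun j => l (i.succAbove j)) (fun j => u (i.succAbove j))
          (fun j => hu _) (by rw [Fin.sum_univ_succAbove _ i] at hN; omega)
        refine ⟨s, v, hv, hs.trans (le_antisymm (Submodule.span_mono ?_) ?_)⟩
        · rintro _ ⟨j, rfl⟩
          exact ⟨_, rfl⟩
        · rw [Submodule.span_le]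
          rintro _ ⟨j, rfl⟩
          rcases eq_or_ne j i with rfl | hj
          · rw [hui]; exact zero_mem _
          · obtain ⟨j, rfl⟩ := Fin.exists_succAbove_eq hj
            exact Submodule.subset_span ⟨j, rfl⟩
    · push Not at hl
      by_cases hli : LinearIndependent (FreeAlgebra k X) u
      · exact ⟨r, u, hli, rfl⟩
      · obtain ⟨i₀, b, hb, hred⟩ := exists_reduction_of_not_linearIndependent u l
          (fun i => Nat.one_le_iff_ne_zero.2 (hl i)) hu hli
        have hsplit : ∑ i, b i • u i = u i₀ + ∑ i ∈ Finset.univ.erase i₀, b i • u i := by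
          rw [← Finset.add_sum_erase _ _ (Finset.mem_univ i₀), hb, one_smul]
        obtain ⟨s, v, hv, hs⟩ := ih r (Function.update l i₀ (l i₀ - 1))
          (Function.update u i₀ (∑ i, b i • u i)) (fun i j => by
            rcases eq_or_ne i i₀ with rfl | hi
            · simpa using hred j
            · simpa [hi] using hu i j) (by
            have h1 := hl i₀
            rw [← Finset.add_sum_erase _ _ (Finset.mem_univ i₀)] at hN ⊢
            rw [Finset.sum_congr rfl (g := fun i => l i + 1) fun i hi => by
              rw [Function.update_of_ne (Finset.ne_of_mem_erase hi)]]
            rw [Function.update_self]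
            omega)
        refine ⟨s, v, hv, hs.trans (le_antisymm ?_ ?_)⟩
        · rw [Submodule.span_le]
          rintro _ ⟨i, rfl⟩
          rcases eq_or_ne i i₀ with rfl | hi
          · rw [Function.update_self]
            exact sum_mem fun i _ => Submodule.smul_mem _ _ (Submodule.subset_span ⟨i, rfl⟩)
          · rw [Function.update_of_ne hi]
            exact Submodule.subset_span ⟨i, rfl⟩
        · have hother : ∀ i, i ≠ i₀ → u i ∈ Submodule.span (FreeAlgebra k X)
              (Set.range (Function.update u i₀ (∑ i, b i • u i))) := fun i hi =>
            Submodule.subset_span ⟨i, Function.update_of_ne hi _ _⟩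
          rw [Submodule.span_le]
          rintro _ ⟨i, rfl⟩
          rcases eq_or_ne i i₀ with rfl | hi
          · rw [← sub_eq_iff_eq_add] at hsplit
            rw [SetLike.mem_coe, ← hsplit]
            refine sub_mem (Submodule.subset_span ⟨i, Function.update_self _ _ _⟩)
              (sum_mem fun j hj => Submodule.smul_mem _ _ (hother j (Finset.ne_of_mem_erase hj)))
          · exact hother i hi

/-- Finitely generated submodules of free modules over a free algebra are free. -/
theorem exists_linearEquiv_of_fg [Fintype X] {J : Type*} [Finite J]
    (P : Submodule (FreeAlgebra k X) (J → FreeAlgebra k X)) (hP : P.FG) :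
    ∃ r : ℕ, Nonempty (P ≃ₗ[FreeAlgebra k X] (Fin r → FreeAlgebra k X)) := by
  obtain ⟨r, u, rfl⟩ := Submodule.fg_iff_exists_fin_generating_family.1 hP
  have := Fintype.ofFinite J
  choose d hd using fun i j => exists_mem_degLT (u i j)
  obtain ⟨s, v, hv, hs⟩ := exists_basis_span_range _ r (fun i => ∑ j, d i j) u
    (fun i j => degLT_mono (Finset.single_le_sum (f := d i) (fun _ _ => Nat.zero_le _)
      (Finset.mem_univ j)) (hd i j)) le_rfl
  exact ⟨s, ⟨(LinearEquiv.ofEq _ _ hs.symm).trans (Module.Basis.span hv).equivFun⟩⟩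

end FreeAlgebra

/-! ### Rank factorizations of idempotent matrices -/

namespace Matrix

variable {R : Type*} [Ring R] {m α : ℕ}

/-- If the image of an idempotent matrix `E` is free of rank `α`, then `E = Γ Δ` with `Δ Γ = 1`:
the rows of `Δ` are a basis of the image, and the columns of `Γ` are the coordinate functions of
`u ↦ u E` in that basis. -/
theorem exists_factorization_of_linearEquiv {E : Matrix (Fin m) (Fin m) R}
    (hE : IsIdempotentElem E) (φ : LinearMap.range (vecMulLinear E) ≃ₗ[R] (Fin α → R)) :
    ∃ (Γ : Matrix (Fin m) (Fin α) R) (Δ : Matrix (Fin α) (Fin m) R), Γ * Δ = E ∧ Δ * Γ = 1 := by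
  let p : (Fin m → R) →ₗ[R] (Fin α → R) := φ.toLinearMap ∘ₗ (vecMulLinear E).rangeRestrict
  let q : (Fin α → R) →ₗ[R] (Fin m → R) :=
    (LinearMap.range (vecMulLinear E)).subtype ∘ₗ φ.symm.toLinearMap
  have hqp : ∀ u, q (p u) = vecMul u E := fun u => by simp [p, q]
  have hpq : ∀ w, p (q w) = w := fun w => by
    obtain ⟨x, hx⟩ := (φ.symm w).2
    have h1 : (vecMulLinear E).rangeRestrict (q w) = φ.symm w := by
      apply Subtype.ext
      change vecMul ((φ.symm w : _) : Fin m → _) E = (φ.symm w : Fin m → _)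
      rw [← hx, vecMulLinear_apply, vecMul_vecMul, hE]
    change φ ((vecMulLinear E).rangeRestrict (q w)) = w
    rw [h1, LinearEquiv.apply_symm_apply]
  refine ⟨LinearMap.toMatrixRight' p, LinearMap.toMatrixRight' q, ?_, ?_⟩
  · apply LinearMap.toMatrixRight'.symm.injective
    refine LinearMap.ext fun u => ?_
    change toLinearMapRight' _ u = toLinearMapRight' _ u
    rw [toLinearMapRight'_mul]
    simpa using hqp u
  · apply LinearMap.toMatrixRight'.symm.injective
    refine LinearMap.ext fun u => ?_
    change toLinearMapRight' _ u = toLinearMapRight' _ u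
    rw [toLinearMapRight'_mul]
    simpa using hpq u

/-- A factorization `E = Γ Δ`, `Δ Γ = 1` of an idempotent matrix, rewritten inside the matrix
ring: the columns of `Γ` and the rows of `Δ` are placed in the column and in the row of index `o`,
so that they become square matrices. -/
theorem exists_dual_families {E : Matrix (Fin m) (Fin m) R}
    (hE : IsIdempotentElem E) (φ : LinearMap.range (vecMulLinear E) ≃ₗ[R] (Fin α → R))
    (o : Fin m) :
    ∃ γ δ : Fin α → Matrix (Fin m) (Fin m) R,
      ∑ i, γ i * δ i = E ∧ (∀ i j, δ i * γ j = if i = j then single o o 1 else 0) ∧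
      (∀ i, γ i * single o o 1 = γ i) ∧ (∀ i, single o o 1 * δ i = δ i) := by
  obtain ⟨Γ, Δ, h1, h2⟩ := exists_factorization_of_linearEquiv hE φ
  let c : Fin α → Matrix (Fin α) (Fin m) R := fun i => single i o 1
  let d : Fin α → Matrix (Fin m) (Fin α) R := fun i => single o i 1
  have hcd : ∀ i, c i * d i = single i i 1 := fun i => by simp [c, d]
  have hdc : ∀ i j, d i * c j = if i = j then single o o 1 else 0 := fun i j => by
    split_ifs with h
    · subst h
      simp [c, d]
    · simp [c, d, h]
  refine ⟨fun i => Γ * c i, fun i => d i * Δ, ?_, fun i j => ?_, fun i => ?_, fun i => ?_⟩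
  · have : ∀ i, Γ * c i * (d i * Δ) = Γ * (c i * d i) * Δ := fun i => by
      simp only [Matrix.mul_assoc]
    simp only [this, hcd]
    rw [← Matrix.sum_mul, ← Matrix.mul_sum, sum_single_one, Matrix.mul_one, h1]
  · rw [Matrix.mul_assoc, ← Matrix.mul_assoc Δ, h2, Matrix.one_mul, hdc]
  · rw [Matrix.mul_assoc]
    simp [c]
  · rw [← Matrix.mul_assoc]
    simp [d]

end Matrix

/-- For every vertex `v`, the idempotent `f(e_v)` is `∑ i, γ i * δ i` for dual families `γ`, `δ` of
`dimVector f v` matrices that are supported in the column, respectively the row, of index `o`. -/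
theorem exists_dual_families_vertex {k V : Type u} [Field k] [Quiver.{u} V] [Fintype V] {m n : ℕ}
    (f : PathAlgebra k V →ₐ[k] FreeMatrix k m n) (o : Fin m) (v : V) :
    ∃ γ δ : Fin (dimVector f v) → FreeMatrix k m n,
      ∑ i, γ i * δ i = f (PathAlgebra.vertex v) ∧
      (∀ i j, δ i * γ j = if i = j then Matrix.single o o 1 else 0) ∧
      (∀ i, γ i * Matrix.single o o 1 = γ i) ∧ (∀ i, Matrix.single o o 1 * δ i = δ i) := by
  have hE : IsIdempotentElem (f (PathAlgebra.vertex v)) := by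
    rw [IsIdempotentElem, ← map_mul, PathAlgebra.vertex, PathAlgebra.ofPath_mul_ofPath]
    rfl
  -- As the image is free, the infimum that defines `dimVector f v` is attained.
  obtain ⟨φ⟩ := Nat.sInf_mem (FreeAlgebra.exists_linearEquiv_of_fg (k := k) (X := Fin n)
    (LinearMap.range (Matrix.vecMulLinear (f (PathAlgebra.vertex v))))
    (by rw [LinearMap.range_eq_map]; exact Submodule.FG.map _ Module.Finite.fg_top))
  exact Matrix.exists_dual_families hE φ o

/-! ### Induction along non-unital homomorphisms and universal localisation -/

section Induced

variable {A B C : Type u} [Ring A] [Ring B] [Ring C]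
variable {P Q : Type u} [AddCommGroup P] [Module A P] [AddCommGroup Q] [Module A Q]

/-- The pure tensor `b ⊗ p` in the induced module `B ⊗_A P`. -/
def Induced.tmul (f : A →ₙ+* B) (b : B) (p : P) : Induced f P :=
  (inducedRel f P).mkQ (b ⊗ₜ[ℤ] p)

namespace Induced

variable (f : A →ₙ+* B)

theorem tmul_add (b : B) (p q : P) : tmul f b (p + q) = tmul f b p + tmul f b q := by
  rw [tmul, TensorProduct.tmul_add, map_add]; rfl

theorem add_tmul (b c : B) (p : P) : tmul f (b + c) p = tmul f b p + tmul f c p := by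
  rw [tmul, TensorProduct.add_tmul, map_add]; rfl

theorem smul_tmul (b c : B) (p : P) : b • tmul f c p = tmul f (b * c) p := by
  rw [tmul, ← map_smul, TensorProduct.smul_tmul', smul_eq_mul]; rfl

theorem mul_tmul (b : B) (a : A) (p : P) : tmul f (b * f a) p = tmul f b (a • p) :=
  (Submodule.Quotient.eq _).2 (Submodule.subset_span ⟨b, a, p, rfl⟩)

variable {f} in
@[elab_as_elim]
theorem induction {motive : Induced f P → Prop} (x : Induced f P) (zero : motive 0)
    (tmul : ∀ b p, motive (tmul f b p)) (add : ∀ x y, motive x → motive y → motive (x + y)) :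
    motive x := by
  obtain ⟨x, rfl⟩ := Submodule.Quotient.mk_surjective _ x
  induction x using TensorProduct.induction_on with
  | zero => exact zero
  | tmul b p => exact tmul b p
  | add x y hx hy => exact add _ _ hx hy

/-- The additive map out of `B ⊗_A P` given by a balanced biadditive map. -/
def liftAdd {Y : Type*} [AddCommGroup Y] (F : B →+ P →+ Y)
    (hF : ∀ b a p, F (b * f a) p = F b (a • p)) : Induced f P →+ Y :=
  QuotientAddGroup.lift (inducedRel f P).toAddSubgroup
    (TensorProduct.liftAddHom F fun n b p => by
      simp only [map_zsmul, AddMonoidHom.coe_smul, Pi.smul_apply]) fun x hx => by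
      replace hx : x ∈ inducedRel f P := hx
      rw [inducedRel, ← Submodule.mem_toAddSubmonoid, Submodule.span_eq_closure] at hx
      induction hx using AddSubmonoid.closure_induction with
      | zero => exact zero_mem _
      | add x y _ _ hx hy => exact add_mem hx hy
      | mem x hx =>
        obtain ⟨c, -, _, ⟨b, a, p, rfl⟩, rfl⟩ := hx
        simp [AddMonoidHom.mem_ker, smul_sub, TensorProduct.smul_tmul', ← mul_assoc, hF]

@[simp] theorem liftAdd_tmul {Y : Type*} [AddCommGroup Y] (F : B →+ P →+ Y)
    (hF : ∀ b a p, F (b * f a) p = F b (a • p)) (b : B) (p : P) :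
    liftAdd f F hF (tmul f b p) = F b p := rfl

end Induced

@[simp] theorem inducedMap_tmul (f : A →ₙ+* B) (σ : P →ₗ[A] Q) (b : B) (p : P) :
    inducedMap f σ (Induced.tmul f b p) = Induced.tmul f b (σ p) := rfl

theorem inducedMap_bijective (f : A →ₙ+* B) (σ : P →ₗ[A] Q) (hσ : Function.Bijective σ) :
    Function.Bijective (inducedMap f σ) := by
  let τ := (LinearEquiv.ofBijective σ hσ).symm
  have h1 : ∀ p, τ (σ p) = p := (LinearEquiv.ofBijective σ hσ).symm_apply_apply
  have h2 : ∀ q, σ (τ q) = q := (LinearEquiv.ofBijective σ hσ).apply_symm_apply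
  refine Function.bijective_iff_has_inverse.2 ⟨inducedMap f τ.toLinearMap, fun x => ?_, fun x => ?_⟩
  · induction x using Induced.induction with
    | zero => simp
    | tmul b p => simp [h1]
    | add x y hx hy => rw [map_add, map_add, hx, hy]
  · induction x using Induced.induction with
    | zero => simp
    | tmul b p => simp [h2]
    | add x y hx hy => rw [map_add, map_add, hx, hy]

/-- Transitivity of induction, `C ⊗_B (B ⊗_A P) ≅ C ⊗_A P`, along ring homomorphisms that need not
preserve the unit. -/
def inducedComp (f : A →ₙ+* B) (h : B →ₙ+* C) (P : Type u) [AddCommGroup P] [Module A P] :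
    Induced h (Induced f P) ≃+ Induced (h.comp f) P :=
  let F : C →+ Induced f P →+ Induced (h.comp f) P := AddMonoidHom.mk' (fun c =>
      Induced.liftAdd f (AddMonoidHom.mk' (fun b =>
        AddMonoidHom.mk' (fun p => Induced.tmul (h.comp f) (c * h b) p) (Induced.tmul_add _ _))
          fun b b' => by ext p; simp [mul_add, Induced.add_tmul])
        fun b a p => by
          simpa [mul_assoc] using Induced.mul_tmul (h.comp f) (c * h b) a p)
      fun c c' => by
        ext x
        induction x using Induced.induction with
        | zero => simp
        | tmul b p => simp [add_mul, Induced.add_tmul]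
        | add x y hx hy => rw [map_add, map_add, hx, hy]
  have hF : ∀ c b p, F c (Induced.tmul f b p) = Induced.tmul (h.comp f) (c * h b) p :=
    fun _ _ _ => rfl
  let G : C →+ P →+ Induced h (Induced f P) := AddMonoidHom.mk' (fun c =>
      AddMonoidHom.mk' (fun p => Induced.tmul h c (Induced.tmul f (f 1) p))
        fun p q => by rw [Induced.tmul_add, Induced.tmul_add])
      fun c c' => by ext p; simp [Induced.add_tmul]
  have hG : ∀ c p, G c p = Induced.tmul h c (Induced.tmul f (f 1) p) := fun _ _ => rfl
  let F' := Induced.liftAdd h F fun c b x => by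
    induction x using Induced.induction with
    | zero => simp
    | tmul b' p => simp [Induced.smul_tmul, hF, mul_assoc]
    | add x y hx hy => rw [smul_add, map_add, map_add, hx, hy]
  let G' := Induced.liftAdd (h.comp f) G fun c a p => by
    rw [hG, hG, ← Induced.mul_tmul, ← map_mul, one_mul, NonUnitalRingHom.comp_apply,
      Induced.mul_tmul, Induced.smul_tmul, ← map_mul, mul_one]
  { toFun := F'
    invFun := G'
    left_inv := fun x => by
      induction x using Induced.induction with
      | zero => simp
      | add x y hx hy => rw [map_add, map_add, hx, hy]
      | tmul c x =>
        induction x using Induced.induction with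
        | zero =>
          have : Induced.tmul h c (0 : Induced f P) = 0 := by simp [Induced.tmul]
          simp [this]
        | add x y hx hy => rw [Induced.tmul_add, map_add, map_add, hx, hy]
        | tmul b p =>
          change Induced.tmul h (c * h b) (Induced.tmul f (f 1) p) = _
          rw [Induced.mul_tmul, Induced.smul_tmul, Induced.mul_tmul, one_smul]
    right_inv := fun x => by
      induction x using Induced.induction with
      | zero => simp
      | add x y hx hy => rw [map_add, map_add, hx, hy]
      | tmul c p =>
        change Induced.tmul (h.comp f) (c * (h.comp f) 1) p = _
        rw [Induced.mul_tmul, one_smul]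
    map_add' := map_add F' }

theorem inducedComp_naturality (f : A →ₙ+* B) (h : B →ₙ+* C) (σ : P →ₗ[A] Q)
    (x : Induced h (Induced f P)) :
    inducedComp f h Q (inducedMap h (inducedMap f σ) x)
      = inducedMap (h.comp f) σ (inducedComp f h P x) := by
  induction x using Induced.induction with
  | zero => simp
  | add x y hx hy => simp only [map_add, hx, hy]
  | tmul c x =>
    induction x using Induced.induction with
    | zero =>
      have : Induced.tmul h c (0 : Induced f P) = 0 := by simp [Induced.tmul]
      simp [this]
    | add x y hx hy => simp only [Induced.tmul_add, map_add, hx, hy]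
    | tmul b p => rfl

theorem inducedMap_comp_bijective_iff (f : A →ₙ+* B) (h : B →ₙ+* C) (σ : P →ₗ[A] Q) :
    Function.Bijective (inducedMap (h.comp f) σ)
      ↔ Function.Bijective (inducedMap h (inducedMap f σ)) := by
  have h1 : (inducedComp f h Q : _ → _) ∘ inducedMap h (inducedMap f σ)
      = inducedMap (h.comp f) σ ∘ inducedComp f h P := funext (inducedComp_naturality f h σ)
  rw [← (inducedComp f h P).bijective.of_comp_iff, ← h1,
    (inducedComp f h Q).bijective.of_comp_iff' ]

/-- Induction along `j : B → C` reflects bijectivity if `j` has a retraction `ρ` that is additive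
and right `B`-linear: every `B`-module is then naturally a retract of the module it induces. -/
theorem bijective_of_inducedMap_bijective (j : B →ₙ+* C) (ρ : C →+ B) (h1 : ρ 1 = 1)
    (hρ : ∀ c b, ρ (c * j b) = ρ c * b) {X Y : Type u} [AddCommGroup X] [Module B X]
    [AddCommGroup Y] [Module B Y] (τ : X →ₗ[B] Y) (hτ : Function.Bijective (inducedMap j τ)) :
    Function.Bijective τ := by
  let r : ∀ (X : Type u) [AddCommGroup X] [Module B X], Induced j X →+ X := fun X _ _ =>
    Induced.liftAdd j (AddMonoidHom.mk' (fun c => AddMonoidHom.mk' (fun x => ρ c • x) (smul_add _))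
      fun c c' => by ext x; simp [add_smul]) fun c b x => by simp [hρ, mul_smul]
  have hr : ∀ (X : Type u) [AddCommGroup X] [Module B X] (c : C) (x : X),
      r X (Induced.tmul j c x) = ρ c • x := fun _ _ _ _ _ => rfl
  have hnat : ∀ z, r Y (inducedMap j τ z) = τ (r X z) := fun z => by
    induction z using Induced.induction with
    | zero => simp
    | add x y hx hy => simp only [map_add, hx, hy]
    | tmul c x => simp [hr]
  constructor
  · intro x y hxy
    have h2 : Induced.tmul j 1 x = Induced.tmul j 1 y := hτ.1 (by simp [hxy])
    simpa [hr, h1] using congrArg (r X) h2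
  · intro y
    obtain ⟨z, hz⟩ := hτ.2 (Induced.tmul j 1 y)
    exact ⟨r X z, by rw [← hnat, hz, hr, h1, one_smul]⟩

end Induced

/-- A homomorphism inverts the maps induced along `j` if and only if its composition with `j`
inverts the original maps. -/
theorem isInverting_inducedSet_iff {A B C : Type u} [Ring A] [Ring B] [Ring C] (j : A →ₙ+* B)
    (S : Set (Arrow (ModuleCat.{u} A))) (g : B →+* C) :
    IsInverting (inducedSet j S) g
      ↔ ∀ σ ∈ S, Function.Bijective (inducedMap ((g : B →ₙ+* C).comp j) σ.hom.hom) := by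
  constructor
  · intro h σ hσ
    exact (inducedMap_comp_bijective_iff j (g : B →ₙ+* C) σ.hom.hom).2 (h _ ⟨σ, hσ, rfl⟩)
  · rintro h _ ⟨σ, hσ, rfl⟩
    exact (inducedMap_comp_bijective_iff j (g : B →ₙ+* C) σ.hom.hom).1 (h σ hσ)

namespace IsUniversalLocalisation

variable {A B C : Type u} [Ring A] [Ring B] [Ring C] {S : Set (Arrow (ModuleCat.{u} A))}
  {f : A →+* B}

/-- The universal property of a universal localisation with respect to ring homomorphisms that
need not preserve the unit: such a homomorphism `g : A → C` takes values in the corner ring at the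
idempotent `g 1`. -/
theorem exists_comp_eq (hf : IsUniversalLocalisation S f) (g : A →ₙ+* C)
    (hg : ∀ σ ∈ S, Function.Bijective (inducedMap g σ.hom.hom)) :
    ∃ h : B →ₙ+* C, h.comp (f : A →ₙ+* B) = g := by
  have hid : IsIdempotentElem (g 1) := by rw [IsIdempotentElem, ← map_mul, one_mul]
  let j : hid.Corner →ₙ+* C :=
    { toFun := fun x => x.1, map_mul' := fun _ _ => rfl, map_add' := fun _ _ => rfl,
      map_zero' := rfl }
  let g' : A →+* hid.Corner :=
    { toFun := fun a => ⟨g a, (Subsemigroup.mem_corner_iff hid).2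
        ⟨by rw [← map_mul, one_mul], by rw [← map_mul, mul_one]⟩⟩
      map_one' := rfl
      map_mul' := fun a b => Subtype.ext (map_mul g a b)
      map_zero' := Subtype.ext (map_zero g)
      map_add' := fun a b => Subtype.ext (map_add g a b) }
  let ρ : C →+ hid.Corner :=
    { toFun := fun c => ⟨g 1 * c * g 1, (Subsemigroup.mem_corner_iff hid).2
        ⟨by rw [← mul_assoc, ← mul_assoc, hid], by rw [mul_assoc, hid]⟩⟩
      map_zero' := Subtype.ext (by simp; rfl)
      map_add' := fun c d => Subtype.ext (by simp [mul_add, add_mul]; rfl) }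
  -- The map `ρ` retracts `C` onto the corner ring, so the corner ring inverts what `C` inverts.
  obtain ⟨h, hh, -⟩ := hf.2 hid.Corner g' fun σ hσ => by
    refine bijective_of_inducedMap_bijective j ρ ?_ (fun c b => ?_) _
      ((inducedMap_comp_bijective_iff (g' : A →ₙ+* hid.Corner) j σ.hom.hom).1 (hg σ hσ))
    · refine Subtype.ext ?_
      change g 1 * 1 * g 1 = g 1
      rw [mul_one, hid]
    · obtain ⟨h1, h2⟩ := (Subsemigroup.mem_corner_iff hid).1 b.2
      refine Subtype.ext ?_
      change g 1 * (c * b.1) * g 1 = g 1 * c * g 1 * b.1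
      rw [mul_assoc, mul_assoc c, h2, mul_assoc (g 1 * c), h1, mul_assoc]
  refine ⟨j.comp (h : B →ₙ+* hid.Corner), NonUnitalRingHom.ext fun a => ?_⟩
  exact congrArg Subtype.val (RingHom.congr_fun hh a)

theorem comp_inverting (hf : IsUniversalLocalisation S f) (h : B →ₙ+* C) :
    ∀ σ ∈ S, Function.Bijective (inducedMap (h.comp (f : A →ₙ+* B)) σ.hom.hom) := fun σ hσ =>
  (inducedMap_comp_bijective_iff (f : A →ₙ+* B) h σ.hom.hom).2
    (inducedMap_bijective h _ (hf.1 σ hσ))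

/-- A universal localisation is an epimorphism also with respect to homomorphisms that need not
preserve the unit: two such homomorphisms that agree on `A` have the same value at the unit, and
hence take values in the same corner ring. -/
theorem nonUnital_hom_ext (hf : IsUniversalLocalisation S f) {h h' : B →ₙ+* C}
    (e : h.comp (f : A →ₙ+* B) = h'.comp (f : A →ₙ+* B)) : h = h' := by
  have hid : IsIdempotentElem (h 1) := by rw [IsIdempotentElem, ← map_mul, one_mul]
  have h1 : h' 1 = h 1 := by
    have h2 : h' (f 1) = h (f 1) := (DFunLike.congr_fun e 1).symm
    rwa [map_one] at h2
  let corner : ∀ l : B →ₙ+* C, l 1 = h 1 → (B →+* hid.Corner) := fun l hl =>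
    { toFun := fun b => ⟨l b, (Subsemigroup.mem_corner_iff hid).2
        ⟨by rw [← hl, ← map_mul, one_mul], by rw [← hl, ← map_mul, mul_one]⟩⟩
      map_one' := Subtype.ext hl
      map_mul' := fun a b => Subtype.ext (map_mul l a b)
      map_zero' := Subtype.ext (map_zero l)
      map_add' := fun a b => Subtype.ext (map_add l a b) }
  have key : corner h rfl = corner h' h1 := by
    refine (hf.2 _ ((corner h' h1).comp f) fun σ hσ => ?_).unique
      (RingHom.ext fun a => Subtype.ext (DFunLike.congr_fun e a)) rfl
    exact (inducedMap_comp_bijective_iff (f : A →ₙ+* B) (corner h' h1 : B →ₙ+* hid.Corner) _).2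
      (inducedMap_bijective _ _ (hf.1 σ hσ))
  exact NonUnitalRingHom.ext fun b => congrArg Subtype.val (RingHom.congr_fun key b)

theorem ringHom_ext (hf : IsUniversalLocalisation S f) {h h' : B →+* C}
    (e : h.comp f = h'.comp f) : h = h' :=
  (hf.2 C (h'.comp f) fun σ hσ => hf.comp_inverting (h' : B →ₙ+* C) σ hσ).unique e rfl

end IsUniversalLocalisation

/-! ### Homomorphisms out of path algebras -/

namespace PathAlgebra

variable {k V : Type u} [Field k] [Quiver.{u} V]

/-- The element of the path algebra given by an arrow. -/
def arrow {a b : V} (e : a ⟶ b) : PathAlgebra k V := ofPath e.toPath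

theorem vertex_mul_self (v : V) : (vertex v * vertex v : PathAlgebra k V) = vertex v :=
  ofPath_mul_ofPath _ _

theorem vertex_mul_vertex_of_ne {v w : V} (h : v ≠ w) :
    (vertex v * vertex w : PathAlgebra k V) = 0 :=
  ofPath_mul_ofPath_of_ne _ _ h.symm

theorem vertex_mul_arrow {a b : V} (e : a ⟶ b) :
    (vertex b * arrow e : PathAlgebra k V) = arrow e :=
  ofPath_mul_ofPath _ _

theorem arrow_mul_vertex {a b : V} (e : a ⟶ b) :
    (arrow e * vertex a : PathAlgebra k V) = arrow e :=
  (ofPath_mul_ofPath _ _).trans (by rw [Quiver.Path.nil_comp]; rfl)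

@[elab_as_elim]
theorem induction_arrow {P : PathAlgebra k V → Prop} (x : PathAlgebra k V) (zero : P 0)
    (add : ∀ y z, P y → P z → P (y + z)) (smul : ∀ (c : k) y, P y → P (c • y))
    (vertex : ∀ v, P (vertex v))
    (arrow_mul : ∀ {a b : V} (e : a ⟶ b) y, P y → P (arrow e * y)) : P x := by
  refine induction_ofPath x zero add fun c a b p => smul c _ ?_
  induction p with
  | nil => exact vertex a
  | cons p e ih =>
    have : (ofPath (p.cons e) : PathAlgebra k V) = arrow e * ofPath p :=
      (ofPath_mul_ofPath e.toPath p).symm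
    rw [this]
    exact arrow_mul e _ ih

section Lift

variable {C : Type*} [Ring C]

/-- The product of the elements `x a` over the arrows `a` of a path, and `e v` for the path of
length zero at `v`. -/
def pathEval (e : V → C) (x : ∀ {a b : V}, (a ⟶ b) → C) : ∀ {a b : V}, Quiver.Path a b → C
  | a, _, .nil => e a
  | _, _, .cons p f => x f * pathEval e x p

variable {e : V → C} {x : ∀ {a b : V}, (a ⟶ b) → C}

theorem pathEval_nil (a : V) : pathEval e x (Quiver.Path.nil : Quiver.Path a a) = e a := by
  rw [pathEval]

theorem pathEval_toPath {a b : V} (f : a ⟶ b) : pathEval e x f.toPath = x f * e a := by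
  rw [Quiver.Hom.toPath, pathEval, pathEval_nil]

theorem pathEval_mul_source (he : ∀ v, e v * e v = e v) {a b : V} (p : Quiver.Path a b) :
    pathEval e x p * e a = pathEval e x p := by
  induction p with
  | nil => rw [pathEval_nil, he]
  | cons p f ih => rw [pathEval, mul_assoc, ih]

theorem target_mul_pathEval (he : ∀ v, e v * e v = e v)
    (hx : ∀ {a b : V} (f : a ⟶ b), e b * x f = x f) {a b : V} (p : Quiver.Path a b) :
    e b * pathEval e x p = pathEval e x p := by
  cases p with
  | nil => rw [pathEval_nil, he]
  | cons p f => rw [pathEval, ← mul_assoc, hx]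

theorem pathEval_comp (he : ∀ v, e v * e v = e v)
    (hx : ∀ {a b : V} (f : a ⟶ b), e b * x f = x f) {a b c : V} (p : Quiver.Path a b)
    (q : Quiver.Path b c) : pathEval e x (p.comp q) = pathEval e x q * pathEval e x p := by
  induction q with
  | nil => rw [Quiver.Path.comp_nil, pathEval_nil, target_mul_pathEval he hx p]
  | cons q f ih => rw [Quiver.Path.comp_cons, pathEval, pathEval, ih, mul_assoc]

/-- The universal property of the path algebra: an algebra homomorphism is given by a complete
family of orthogonal idempotents `e v` for the vertices, and by elements `x a` for the arrows with
`e t * x a = x a` for the target `t` of `a`.  The arrow `a` is then sent to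
`x a * e s`, where `s` is the source of `a`; see `lift_arrow` for the case that this is `x a`. -/
def lift [Fintype V] [Algebra k C] (e : V → C) (x : ∀ {a b : V}, (a ⟶ b) → C)
    (he : ∀ v, e v * e v = e v) (horth : ∀ v w, v ≠ w → e v * e w = 0) (hsum : ∑ v, e v = 1)
    (hx : ∀ {a b : V} (f : a ⟶ b), e b * x f = x f) :
    PathAlgebra k V →ₐ[k] C :=
  AlgHom.ofLinearMap (linLift fun p => pathEval e x p.2.2)
    (by
      rw [one_def, map_sum, ← hsum]
      exact Finset.sum_congr rfl fun v _ => (linLift_ofPath _ _).trans (pathEval_nil v))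
    (fun y z => by
      refine induction_ofPath
        (P := fun y => linLift _ (y * z) = linLift _ y * linLift _ z) y (by simp)
        (fun u v hu hv => by rw [add_mul, map_add, map_add, hu, hv, add_mul]) fun r c d p => ?_
      refine induction_ofPath
        (P := fun z => linLift _ (_ * z) = linLift _ _ * linLift _ z) z (by simp)
        (fun u v hu hv => by rw [mul_add, map_add, map_add, hu, hv, mul_add]) fun s a b q => ?_
      simp only [smul_mul_assoc, mul_smul_comm, map_smul, linLift_ofPath]
      by_cases h : b = c
      · subst h
        rw [ofPath_mul_ofPath, linLift_ofPath, pathEval_comp he hx]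
      · rw [ofPath_mul_ofPath_of_ne _ _ h, map_zero, ← pathEval_mul_source he p,
          ← target_mul_pathEval he hx q, mul_assoc, ← mul_assoc (e c), horth c b (Ne.symm h),
          zero_mul, mul_zero, smul_zero, smul_zero])

variable [Fintype V] [Algebra k C] (he : ∀ v, e v * e v = e v)
  (horth : ∀ v w, v ≠ w → e v * e w = 0) (hsum : ∑ v, e v = 1)
  (hx : ∀ {a b : V} (f : a ⟶ b), e b * x f = x f)

@[simp] theorem lift_vertex (v : V) :
    lift (k := k) e x he horth hsum hx (vertex v) = e v :=
  (linLift_ofPath _ _).trans (pathEval_nil v)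

theorem lift_arrow {a b : V} (f : a ⟶ b) (hf : x f * e a = x f) :
    lift (k := k) e x he horth hsum hx (arrow f) = x f :=
  (linLift_ofPath _ _).trans ((pathEval_toPath f).trans hf)

end Lift

end PathAlgebra

/-! ### Quiver representations from Peirce components of modules -/

section CornerRepresentations

open scoped ModuleCat

/-- An idempotent `e w` of a ring `B` for every vertex `w` of a quiver, and an element
`x a` of the Peirce component `e t B e s` for every arrow `a : s ⟶ t`. -/
structure PeirceData (B : Type*) [Ring B] (W : Type*) [Quiver.{u} W] where
  e : W → B
  x : ∀ {s t : W}, (s ⟶ t) → B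
  e_mul_e : ∀ w, e w * e w = e w
  e_mul_x : ∀ {s t : W} (a : s ⟶ t), e t * x a = x a
  x_mul_e : ∀ {s t : W} (a : s ⟶ t), x a * e s = x a

namespace PeirceData

variable {k : Type u} [Field k] {B : Type u} [Ring B] [Algebra k B] {W : Type*} [Quiver.{u} W]
  (D : PeirceData B W)

/-- The subspace `e w N` of a `B`-module `N`. -/
def corner (N : ModuleCat.{u} B) (w : W) : Submodule k N where
  carrier := {n | D.e w • n = n}
  add_mem' {n m} hn hm := by
    change D.e w • (n + m) = n + m
    rw [smul_add, hn, hm]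
  zero_mem' := smul_zero _
  smul_mem' c n hn := by
    change D.e w • c • n = c • n
    rw [smul_algebra_smul_comm, hn]

variable {D} in
theorem smul_mem_corner {N : ModuleCat.{u} B} {w : W} {b : B} (hb : D.e w * b = b) (n : N) :
    b • n ∈ (D.corner N w : Submodule k N) := by
  change D.e w • b • n = b • n
  rw [← mul_smul, hb]

/-- The action of an element `b = e t b` on a `B`-module `N`, as a map `e s N → e t N`. -/
def cornerMap (N : ModuleCat.{u} B) {s t : W} (b : B) (hb : D.e t * b = b) :
    (D.corner N s : Submodule k N) →ₗ[k] (D.corner N t : Submodule k N) where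
  toFun n := ⟨b • n.1, smul_mem_corner hb n.1⟩
  map_add' n m := Subtype.ext (smul_add b n.1 m.1)
  map_smul' c n := Subtype.ext (smul_algebra_smul_comm c b n.1)

variable (k) in
/-- The spaces `e w N` and the maps between them given by the arrows. -/
def prerep (N : ModuleCat.{u} B) : W ⥤q ModuleCat.{u} k where
  obj w := ModuleCat.of k (D.corner N w : Submodule k N)
  map a := ModuleCat.ofHom (D.cornerMap N (D.x a) (D.e_mul_x a))

variable (k) in
/-- The representation `w ↦ e w N` of the quiver afforded by a `B`-module `N`. -/
def rep (N : ModuleCat.{u} B) : QuiverRep k W := Paths.lift (D.prerep k N)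

/-- The inclusion of `e w N` into `N`. -/
def val (N : ModuleCat.{u} B) (w : W) : (D.rep k N).obj w →ₗ[k] N :=
  (D.corner N w : Submodule k N).subtype

/-- The map `N → e w N` given by the action of `e w`. -/
def proj (N : ModuleCat.{u} B) (w : W) : N →ₗ[k] (D.rep k N).obj w where
  toFun n := (⟨D.e w • n, smul_mem_corner (D.e_mul_e w) n⟩ : (D.corner N w : Submodule k N))
  map_add' n m := Subtype.ext (smul_add _ n m)
  map_smul' c n := Subtype.ext (smul_algebra_smul_comm c (D.e w) n)

theorem val_injective (N : ModuleCat.{u} B) (w : W) : Function.Injective (D.val (k := k) N w) :=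
  Subtype.val_injective

theorem e_smul_val (N : ModuleCat.{u} B) (w : W) (n : (D.rep k N).obj w) :
    D.e w • D.val N w n = D.val N w n :=
  (n : (D.corner N w : Submodule k N)).2

theorem val_proj (N : ModuleCat.{u} B) (w : W) (n : N) :
    D.val (k := k) N w (D.proj N w n) = D.e w • n := rfl

theorem proj_val (N : ModuleCat.{u} B) (w : W) (n : (D.rep k N).obj w) :
    D.proj N w (D.val N w n) = n :=
  D.val_injective N w (D.e_smul_val N w n)

theorem val_map_arrow (N : ModuleCat.{u} B) {s t : W} (a : s ⟶ t) (n : (D.rep k N).obj s) :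
    D.val N t (((D.rep k N).map a.toPath).hom n) = D.x a • D.val N s n :=
  congrArg (fun f : (D.prerep k N).obj s ⟶ (D.prerep k N).obj t => D.val N t (f.hom n))
    (Paths.lift_toPath (D.prerep k N) a)

end PeirceData

/-- A morphism of quiver representations may be given on vertices, with naturality checked on
arrows. -/
def QuiverRep.homMk {k : Type u} [Field k] {W : Type*} [Quiver.{u} W] {L M : QuiverRep k W}
    (φ : ∀ w : W, L.obj w ⟶ M.obj w)
    (h : ∀ {s t : W} (a : s ⟶ t), L.map a.toPath ≫ φ t = φ s ≫ M.map a.toPath) : L ⟶ M where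
  app w := φ w
  naturality s t p := by
    induction p using Paths.induction with
    | id => simp
    | @comp u v w p q hp =>
      have key : ∀ {X Y Z X' Y' Z' : ModuleCat.{u} k} {f : X ⟶ Y} {g : Y ⟶ Z} {f' : X' ⟶ Y'}
          {g' : Y' ⟶ Z'} {x : X ⟶ X'} {y : Y ⟶ Y'} {z : Z ⟶ Z'}, f ≫ y = x ≫ f' →
          g ≫ z = y ≫ g' → (f ≫ g) ≫ z = x ≫ f' ≫ g' := fun h₁ h₂ => by
        rw [Category.assoc, h₂, reassoc_of% h₁]
      have hL : L.map (p ≫ (Paths.of W).map q) = L.map p ≫ L.map q.toPath := L.map_comp _ _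
      have hM : M.map (p ≫ (Paths.of W).map q) = M.map p ≫ M.map q.toPath := M.map_comp _ _
      exact (congrArg (fun f => f ≫ φ w) hL).trans
        ((key hp (h q)).trans (congrArg (fun f => φ u ≫ f) hM.symm))

theorem QuiverRep.hom_ext {k : Type u} [Field k] {W : Type*} [Quiver.{u} W]
    {L M : QuiverRep k W} {φ ψ : L ⟶ M}
    (h : ∀ (w : W) (l : L.obj w), (φ.app w).hom l = (ψ.app w).hom l) : φ = ψ :=
  NatTrans.ext (funext fun w => ModuleCat.hom_ext (LinearMap.ext (h w)))

theorem QuiverRep.naturality_arrow {k : Type u} [Field k] {W : Type*} [Quiver.{u} W]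
    {L M : QuiverRep k W} (φ : L ⟶ M) {s t : W} (a : s ⟶ t) (l : L.obj s) :
    (φ.app t).hom ((L.map a.toPath).hom l) = (M.map a.toPath).hom ((φ.app s).hom l) :=
  congrArg (fun f => f.hom l) (φ.naturality (X := s) (Y := t) a.toPath)

namespace PeirceData

variable {k : Type u} [Field k] {B : Type u} [Ring B] [Algebra k B] {W : Type*} [Quiver.{u} W]
  (D : PeirceData B W)

variable (k) in
/-- The functor `N ↦ (e w N)_w` from `B`-modules to quiver representations. -/
def repFunctor : ModuleCat.{u} B ⥤ QuiverRep k W where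
  obj N := D.rep k N
  map {N N'} f := QuiverRep.homMk
    (fun w => ModuleCat.ofHom
      (D.proj N' w ∘ₗ (f.hom.restrictScalars k) ∘ₗ D.val N w))
    fun {s t} a => by
      ext n
      apply D.val_injective N' t
      change D.e t • f.hom (D.val N t (((D.rep k N).map a.toPath).hom n))
        = D.val N' t (((D.rep k N').map a.toPath).hom (D.proj N' s (f.hom (D.val N s n))))
      rw [val_map_arrow, val_map_arrow, val_proj, map_smul, ← mul_smul, ← mul_smul, D.e_mul_x,
        D.x_mul_e]
  map_id N := QuiverRep.hom_ext fun w n => D.proj_val N w n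
  map_comp {N N' N''} f g := QuiverRep.hom_ext fun w n => D.val_injective N'' w (by
    change D.e w • g.hom (f.hom (D.val N w n)) = D.e w • g.hom (D.e w • f.hom (D.val N w n))
    rw [← map_smul f.hom, e_smul_val])

theorem val_repFunctor_map {N N' : ModuleCat.{u} B} (f : N ⟶ N') (w : W)
    (n : (D.rep k N).obj w) :
    D.val N' w ((((D.repFunctor k).map f).app w).hom n) = f.hom (D.val N w n) := by
  change D.e w • f.hom (D.val N w n) = f.hom (D.val N w n)
  rw [← map_smul, e_smul_val]

instance : (D.repFunctor k).Additive where
  map_add {N N' f g} := QuiverRep.hom_ext fun w n =>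
    map_add (D.proj N' w) (f.hom (D.val N w n)) (g.hom (D.val N w n))

instance : (D.repFunctor k).Linear k where
  map_smul {N N'} f c := QuiverRep.hom_ext fun w n =>
    map_smul (D.proj N' w) c (f.hom (D.val N w n))

/-- The elements of `e t B e s` that are linear combinations of products of the chosen elements
along paths of the quiver. -/
inductive Gen (k : Type u) [Field k] {B : Type u} [Ring B] [Algebra k B] {W : Type*}
    [Quiver.{u} W] (D : PeirceData B W) : W → W → B → Prop
  | e (w : W) : Gen k D w w (D.e w)
  | x {s t : W} (a : s ⟶ t) : Gen k D s t (D.x a)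
  | zero (s t : W) : Gen k D s t 0
  | add {s t : W} {b b' : B} : Gen k D s t b → Gen k D s t b' → Gen k D s t (b + b')
  | smul {s t : W} (c : k) {b : B} : Gen k D s t b → Gen k D s t (c • b)
  | mul {s t u : W} {b b' : B} : Gen k D t u b → Gen k D s t b' → Gen k D s u (b * b')

theorem Gen.sum {s t : W} {ι : Type*} (I : Finset ι) (b : ι → B)
    (h : ∀ i ∈ I, Gen k D s t (b i)) : Gen k D s t (∑ i ∈ I, b i) := by
  classical
  induction I using Finset.induction_on with
  | empty => simpa using Gen.zero s t
  | insert i I hi ih =>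
    rw [Finset.sum_insert hi]
    exact (h i (Finset.mem_insert_self i I)).add
      (ih fun j hj => h j (Finset.mem_insert_of_mem hj))

theorem Gen.smul_natural {N N' : ModuleCat.{u} B} (ψ : D.rep k N ⟶ D.rep k N') {s t : W} {b : B}
    (hb : Gen k D s t b) (n : N) :
    D.val N' t ((ψ.app t).hom (D.proj N t (b • n)))
      = b • D.val N' s ((ψ.app s).hom (D.proj N s n)) := by
  induction hb generalizing n with
  | e w =>
    have h1 : D.proj (k := k) N w (D.e w • n) = D.proj N w n := D.proj_val N w (D.proj N w n)
    rw [h1, e_smul_val]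
  | @x s t a =>
    have h1 : D.proj N t (D.x a • n) = ((D.rep k N).map a.toPath).hom (D.proj N s n) :=
      D.val_injective N t (by
        rw [val_map_arrow, val_proj, val_proj, ← mul_smul, ← mul_smul, D.e_mul_x, D.x_mul_e])
    rw [h1, QuiverRep.naturality_arrow, val_map_arrow]
  | zero => simp
  | add _ _ h1 h2 => rw [add_smul, map_add, map_add, map_add, h1, h2, add_smul]
  | smul c _ h => rw [smul_assoc, map_smul, map_smul, map_smul, h, smul_assoc]
  | mul _ _ h1 h2 => rw [mul_smul, h1, h2, mul_smul]

variable {J : Type*} [Fintype J] (w : J → W) (c d : J → B)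

theorem repFunctor_faithful (hcd : ∑ j, c j * d j = 1) (hd : ∀ j, D.e (w j) * d j = d j) :
    (D.repFunctor k).Faithful where
  map_injective {N N'} f f' h := by
    ext n
    have key : ∀ j, f.hom (d j • n) = f'.hom (d j • n) := fun j => by
      have h1 : D.val (k := k) N (w j) (D.proj N (w j) (d j • n)) = d j • n := by
        rw [val_proj, ← mul_smul, hd]
      rw [← h1, ← val_repFunctor_map, ← val_repFunctor_map, h]
    rw [← one_smul B n, ← hcd, Finset.sum_smul, map_sum, map_sum]
    refine Finset.sum_congr rfl fun j _ => ?_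
    rw [mul_smul, (f.hom).map_smul (c j), (f'.hom).map_smul (c j), key]

/-- A morphism `ψ` of representations is extended to the `B`-module `N` through the partition of
unity `1 = ∑ j, c j * d j`, by the formula `n ↦ ∑ j, c j • ψ (d j • n)`. -/
theorem repFunctor_full (hcd : ∑ j, c j * d j = 1) (hde : ∀ v j, Gen k D v (w j) (d j * D.e v))
    (hgen : ∀ b j l, Gen k D (w l) (w j) (d j * b * c l)) : (D.repFunctor k).Full where
  map_surjective {N N'} ψ := by
    let Ψ : ∀ w : W, N →ₗ[k] N' := fun w => D.val N' w ∘ₗ (ψ.app w).hom ∘ₗ D.proj N w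
    have hΨ : ∀ {s t : W} {b : B}, Gen k D s t b → ∀ n, Ψ t (b • n) = b • Ψ s n :=
      fun hb n => hb.smul_natural D ψ n
    let Φ : N →+ N' :=
      { toFun := fun n => ∑ j, c j • Ψ (w j) (d j • n)
        map_zero' := by simp
        map_add' := fun n m => by simp only [smul_add, map_add, Finset.sum_add_distrib] }
    have hΦ : ∀ n, Φ n = ∑ j, c j • Ψ (w j) (d j • n) := fun _ => rfl
    have hlin : ∀ (b : B) n, Φ (b • n) = b • Φ n := fun b n => by
      have h1 : ∀ j, d j • b • n = ∑ l, (d j * b * c l) • d l • n := fun j => by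
        conv_lhs => rw [← one_smul B n, ← hcd, Finset.sum_smul, Finset.smul_sum, Finset.smul_sum]
        simp only [mul_smul]
      have h2 : b = ∑ j, c j * (d j * b) := by
        simp only [← mul_assoc, ← Finset.sum_mul]
        rw [hcd, one_mul]
      simp only [hΦ, h1, map_sum, hΨ (hgen b _ _), Finset.smul_sum]
      rw [Finset.sum_comm]
      refine Finset.sum_congr rfl fun l _ => ?_
      conv_rhs => rw [h2]
      simp only [← mul_smul, ← Finset.sum_smul, Finset.sum_mul, mul_assoc]
    refine ⟨ModuleCat.ofHom { Φ with map_smul' := hlin }, ?_⟩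
    refine QuiverRep.hom_ext fun v n => ?_
    apply D.val_injective N' v
    refine (D.val_repFunctor_map _ v n).trans ?_
    change Φ (D.val N v n) = _
    have h3 : Ψ v (D.val N v n) = D.val N' v ((ψ.app v).hom n) :=
      congrArg (fun n => D.val N' v ((ψ.app v).hom n)) (D.proj_val N v n)
    have h5 : D.e v • D.val N' v ((ψ.app v).hom n) = D.val N' v ((ψ.app v).hom n) :=
      D.e_smul_val N' v _
    have h4 : ∀ j, c j • Ψ (w j) (d j • D.val N v n)
        = (c j * d j) • D.val N' v ((ψ.app v).hom n) := fun j => by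
      rw [← e_smul_val D N v n, ← mul_smul, hΨ (hde v j), h3, mul_smul, h5, mul_smul]
    rw [hΦ, Finset.sum_congr rfl fun j _ => h4 j, ← Finset.sum_smul, hcd, one_smul]

/-- The elements `b` of `B` all of whose matrix coefficients `d j * b * c l` with respect to a
partition of unity `∑ j, c j * d j = 1` are combinations of path products. -/
def genSubalgebra (hcd : ∑ j, c j * d j = 1) (h1 : ∀ j l, Gen k D (w l) (w j) (d j * c l)) :
    Subalgebra k B where
  carrier := {b | ∀ j l, Gen k D (w l) (w j) (d j * b * c l)}
  mul_mem' {a b} ha hb j l := by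
    have : d j * (a * b) * c l = ∑ i, (d j * a * c i) * (d i * b * c l) := by
      conv_lhs => rw [← mul_one a, ← hcd]
      simp only [Finset.mul_sum, Finset.sum_mul, mul_assoc]
    rw [this]
    exact Gen.sum D _ _ fun i _ => (ha j i).mul (hb i l)
  add_mem' {a b} ha hb j l := by
    rw [mul_add, add_mul]
    exact (ha j l).add (hb j l)
  algebraMap_mem' r j l := by
    rw [← Algebra.commutes, mul_assoc, ← Algebra.smul_def]
    exact (h1 j l).smul r

/-- A `B`-module `N` affords a given representation `L` as soon as the spaces `e w N` are
identified with the spaces of `L` compatibly with the arrows. -/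
theorem nonempty_iso_rep (N : ModuleCat.{u} B) (L : QuiverRep k W)
    (ι : ∀ w : W, L.obj w →+ N) (π : ∀ w : W, N → L.obj w)
    (hι : ∀ (w : W) (c : k) (l : L.obj w), ι w (c • l) = c • ι w l)
    (hπι : ∀ (w : W) l, π w (ι w l) = l) (hιπ : ∀ (w : W) n, ι w (π w n) = D.e w • n)
    (hx : ∀ {s t : W} (a : s ⟶ t) (l : L.obj s), D.x a • ι s l = ι t ((L.map a.toPath).hom l)) :
    Nonempty (D.rep k N ≅ L) := by
  let ι' : ∀ w : W, L.obj w →ₗ[k] N := fun w => { ι w with map_smul' := hι w }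
  have he : ∀ (w : W) l, D.e w • ι w l = ι w l := fun w l => by rw [← hιπ, hπι]
  let φ : L ⟶ D.rep k N := QuiverRep.homMk (fun w => ModuleCat.ofHom (D.proj N w ∘ₗ ι' w))
    fun {s t} a => by
      ext l
      apply D.val_injective N t
      change D.e t • ι t ((L.map a.toPath).hom l)
        = D.val N t (((D.rep k N).map a.toPath).hom (D.proj N s (ι s l)))
      rw [val_map_arrow, val_proj, he, he, hx]
  have hφ : ∀ (w : W) l, D.val (k := k) N w ((φ.app w).hom l) = ι w l := fun w l => he w l
  have : ∀ w : W, IsIso (φ.app w) := fun w => by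
    rw [ConcreteCategory.isIso_iff_bijective]
    constructor
    · intro l l' h
      have h1 : ι w l = ι w l' := by rw [← hφ, ← hφ]; exact congrArg _ h
      have h2 := congrArg (π w) h1
      rwa [hπι, hπι] at h2
    · intro n
      refine ⟨π w (D.val N w n), D.val_injective N w ?_⟩
      exact (hφ w _).trans ((hιπ w _).trans (D.e_smul_val N w n))
  have : ∀ w : Paths W, IsIso (φ.app w) := this
  have : IsIso φ := NatIso.isIso_of_isIso_app φ
  exact ⟨(asIso φ).symm⟩

end PeirceData

end CornerRepresentations

/-! ### Homomorphisms out of the localisation for the joined quiver -/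

/-- A homomorphism of algebras that inverts the maps induced along a non-unital inclusion extends
over the localisation of the included algebra; the extension is linear over the ground field, as
scalars come from the included algebra. -/
theorem IsUniversalLocalisation.exists_nonUnitalAlgHom {k A M P B : Type u} [Field k] [Ring A]
    [Algebra k A] [Ring M] [Algebra k M] [Ring P] [Algebra k P] [Ring B] [Algebra k B]
    {S : Set (Arrow (ModuleCat.{u} A))} {f : A →ₐ[k] M}
    (hf : IsUniversalLocalisation S (f : A →+* M)) {j : A →ₙ+* P}
    (hj : ∀ (c : k) x, j (c • x) = c • j x) (g : P →ₐ[k] B)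
    (hg : IsInverting (inducedSet j S) (g : P →+* B)) :
    ∃ h : M →ₙₐ[k] B, ∀ x, h (f x) = g (j x) := by
  obtain ⟨h, hh⟩ := hf.exists_comp_eq (((g : P →+* B) : P →ₙ+* B).comp j)
    ((isInverting_inducedSet_iff j S _).1 hg)
  have hh' : ∀ x, h (f x) = g (j x) := DFunLike.congr_fun hh
  have smul : ∀ (c : k) x, h (c • x) = c • h x := fun c x => by
    have e : h (f (c • 1)) = c • h 1 := by
      rw [hh', hj, map_smul, ← hh', map_one f]
    rw [← one_mul x, ← smul_mul_assoc, map_mul, map_mul, ← smul_mul_assoc, ← e, map_smul f,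
      map_one f]
  exact ⟨{ h with map_smul' := smul }, hh'⟩

section Gluing

variable {k V₁ V₂ : Type u} [Field k] [Quiver.{u} V₁] [Fintype V₁] [Quiver.{u} V₂] [Fintype V₂]
  {M₁ M₂ : Type u} [Ring M₁] [Algebra k M₁] [Ring M₂] [Algebra k M₂]

namespace JoinQuiver

variable {E₁₂ : V₁ → V₂ → Type u} {E₂₁ : V₂ → V₁ → Type u}

/-- An added arrow from the first to the second quiver. -/
def hom₁₂ {a : V₁} {b : V₂} (e : E₁₂ a b) :
    (incl₁ E₁₂ E₂₁).obj a ⟶ (incl₂ E₁₂ E₂₁).obj b :=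
  JoinArrow.new₁₂ e

/-- An added arrow from the second to the first quiver. -/
def hom₂₁ {b : V₂} {a : V₁} (e : E₂₁ b a) :
    (incl₂ E₁₂ E₂₁).obj b ⟶ (incl₁ E₁₂ E₂₁).obj a :=
  JoinArrow.new₂₁ e

variable (k) in
/-- The element of the path algebra of the joined quiver given by an added arrow from the first to
the second quiver. -/
def added₁₂ {a : V₁} {b : V₂} (e : E₁₂ a b) : PathAlgebra k (JoinQuiver E₁₂ E₂₁) :=
  PathAlgebra.arrow (hom₁₂ e)

variable (k) in
/-- The element of the path algebra of the joined quiver given by an added arrow from the second to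
the first quiver. -/
def added₂₁ {b : V₂} {a : V₁} (e : E₂₁ b a) : PathAlgebra k (JoinQuiver E₁₂ E₂₁) :=
  PathAlgebra.arrow (hom₂₁ e)

variable (k E₁₂ E₂₁) in
/-- The inclusion of the path algebra of the first quiver. -/
abbrev map₁ : PathAlgebra k V₁ →ₙ+* PathAlgebra k (JoinQuiver E₁₂ E₂₁) :=
  PathAlgebra.map (incl₁ E₁₂ E₂₁) Sum.inl_injective

variable (k E₁₂ E₂₁) in
/-- The inclusion of the path algebra of the second quiver. -/
abbrev map₂ : PathAlgebra k V₂ →ₙ+* PathAlgebra k (JoinQuiver E₁₂ E₂₁) :=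
  PathAlgebra.map (incl₂ E₁₂ E₂₁) Sum.inr_injective

theorem map₁_smul (c : k) (x : PathAlgebra k V₁) : map₁ k E₁₂ E₂₁ (c • x) = c • map₁ k E₁₂ E₂₁ x :=
  map_smul (PathAlgebra.linLift _) c x

theorem map₂_smul (c : k) (x : PathAlgebra k V₂) : map₂ k E₁₂ E₂₁ (c • x) = c • map₂ k E₁₂ E₂₁ x :=
  map_smul (PathAlgebra.linLift _) c x

theorem map₁_vertex (v : V₁) : map₁ k E₁₂ E₂₁ (PathAlgebra.vertex v)
    = PathAlgebra.vertex ((incl₁ E₁₂ E₂₁).obj v) :=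
  PathAlgebra.map_ofPath _ _ _

theorem map₂_vertex (v : V₂) : map₂ k E₁₂ E₂₁ (PathAlgebra.vertex v)
    = PathAlgebra.vertex ((incl₂ E₁₂ E₂₁).obj v) :=
  PathAlgebra.map_ofPath _ _ _

theorem map₁_arrow {a b : V₁} (e : a ⟶ b) : map₁ k E₁₂ E₂₁ (PathAlgebra.arrow e)
    = PathAlgebra.arrow ((incl₁ E₁₂ E₂₁).map e) :=
  PathAlgebra.map_ofPath _ _ _

theorem map₂_arrow {a b : V₂} (e : a ⟶ b) : map₂ k E₁₂ E₂₁ (PathAlgebra.arrow e)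
    = PathAlgebra.arrow ((incl₂ E₁₂ E₂₁).map e) :=
  PathAlgebra.map_ofPath _ _ _

theorem one_eq :
    (1 : PathAlgebra k (JoinQuiver E₁₂ E₂₁)) = map₁ k E₁₂ E₂₁ 1 + map₂ k E₁₂ E₂₁ 1 := by
  rw [PathAlgebra.one_def, PathAlgebra.one_def, PathAlgebra.one_def, map_sum, map_sum]
  simp only [map₁_vertex, map₂_vertex]
  exact Fintype.sum_sum_type _

theorem map₁_one_mul_map₂_one : map₁ k E₁₂ E₂₁ 1 * map₂ k E₁₂ E₂₁ 1 = 0 := by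
  rw [PathAlgebra.one_def, PathAlgebra.one_def, map_sum, map_sum, Finset.sum_mul_sum]
  refine Finset.sum_eq_zero fun a _ => Finset.sum_eq_zero fun b _ => ?_
  rw [map₁_vertex, map₂_vertex]
  exact PathAlgebra.vertex_mul_vertex_of_ne Sum.inl_ne_inr

theorem map₂_one_mul_map₁_one : map₂ k E₁₂ E₂₁ 1 * map₁ k E₁₂ E₂₁ 1 = 0 := by
  rw [PathAlgebra.one_def, PathAlgebra.one_def, map_sum, map_sum, Finset.sum_mul_sum]
  refine Finset.sum_eq_zero fun a _ => Finset.sum_eq_zero fun b _ => ?_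
  rw [map₁_vertex, map₂_vertex]
  exact PathAlgebra.vertex_mul_vertex_of_ne Sum.inr_ne_inl

/-- The path algebra of the joined quiver is generated by the two path algebras and the added
arrows. -/
theorem mem_subalgebra {s : Subalgebra k (PathAlgebra k (JoinQuiver E₁₂ E₂₁))}
    (h₁ : ∀ x, map₁ k E₁₂ E₂₁ x ∈ s) (h₂ : ∀ x, map₂ k E₁₂ E₂₁ x ∈ s)
    (h₁₂ : ∀ {a b} (e : E₁₂ a b), added₁₂ k e ∈ s) (h₂₁ : ∀ {b a} (e : E₂₁ b a), added₂₁ k e ∈ s)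
    (x : PathAlgebra k (JoinQuiver E₁₂ E₂₁)) : x ∈ s := by
  induction x using PathAlgebra.induction_arrow with
  | zero => exact zero_mem _
  | add y z hy hz => exact add_mem hy hz
  | smul c y hy => exact s.smul_mem hy c
  | vertex v =>
    rcases v with v | v
    · exact map₁_vertex (k := k) (E₁₂ := E₁₂) (E₂₁ := E₂₁) v ▸ h₁ _
    · exact map₂_vertex (k := k) (E₁₂ := E₁₂) (E₂₁ := E₂₁) v ▸ h₂ _
  | arrow_mul e y hy =>
    refine mul_mem ?_ hy
    rcases e with e | e | e | e
    · exact map₁_arrow (k := k) (E₁₂ := E₁₂) (E₂₁ := E₂₁) e ▸ h₁ _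
    · exact map₂_arrow (k := k) (E₁₂ := E₁₂) (E₂₁ := E₂₁) e ▸ h₂ _
    · exact h₁₂ e
    · exact h₂₁ e

end JoinQuiver

open JoinQuiver

/-- A homomorphism from the path algebra of the joined quiver to an algebra `C`, together with
extensions to `M₁` and `M₂` of its restrictions to the path algebras of the two quivers, along the
given homomorphisms `f₁` and `f₂`.  The extensions do not preserve the unit. -/
structure GluedHom (f₁ : PathAlgebra k V₁ →ₐ[k] M₁) (f₂ : PathAlgebra k V₂ →ₐ[k] M₂)
    (E₁₂ : V₁ → V₂ → Type u) (E₂₁ : V₂ → V₁ → Type u) (C : Type u) [Ring C] [Algebra k C] where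
  g : PathAlgebra k (JoinQuiver E₁₂ E₂₁) →ₐ[k] C
  h₁ : M₁ →ₙₐ[k] C
  h₂ : M₂ →ₙₐ[k] C
  h₁_comp : ∀ x, h₁ (f₁ x) = g (map₁ k E₁₂ E₂₁ x)
  h₂_comp : ∀ x, h₂ (f₂ x) = g (map₂ k E₁₂ E₂₁ x)

namespace GluedHom

variable {f₁ : PathAlgebra k V₁ →ₐ[k] M₁} {f₂ : PathAlgebra k V₂ →ₐ[k] M₂}
  {E₁₂ : V₁ → V₂ → Type u} {E₂₁ : V₂ → V₁ → Type u} {B C : Type u} [Ring B] [Algebra k B] [Ring C]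
  [Algebra k C] (G : GluedHom f₁ f₂ E₁₂ E₂₁ B)

theorem h₁_one : G.h₁ 1 = G.g (map₁ k E₁₂ E₂₁ 1) := by rw [← h₁_comp, map_one f₁]

theorem h₂_one : G.h₂ 1 = G.g (map₂ k E₁₂ E₂₁ 1) := by rw [← h₂_comp, map_one f₂]

theorem h₁_one_add_h₂_one : G.h₁ 1 + G.h₂ 1 = 1 := by
  rw [h₁_one, h₂_one, ← map_add, ← one_eq, map_one]

theorem h₁_mul_h₂ (x : M₁) (y : M₂) : G.h₁ x * G.h₂ y = 0 := by
  rw [← mul_one x, ← one_mul y, map_mul, map_mul, mul_assoc, ← mul_assoc (G.h₁ 1), h₁_one, h₂_one,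
    ← map_mul, map₁_one_mul_map₂_one, map_zero, zero_mul, mul_zero]

theorem h₂_mul_h₁ (x : M₂) (y : M₁) : G.h₂ x * G.h₁ y = 0 := by
  rw [← mul_one x, ← one_mul y, map_mul, map_mul, mul_assoc, ← mul_assoc (G.h₂ 1), h₁_one, h₂_one,
    ← map_mul, map₂_one_mul_map₁_one, map_zero, zero_mul, mul_zero]

theorem h₂_mul_added₁₂ {a : V₁} {b : V₂} (e : E₁₂ a b) :
    G.h₂ (f₂ (PathAlgebra.vertex b)) * G.g (added₁₂ k e) = G.g (added₁₂ k e) := by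
  rw [h₂_comp, map₂_vertex, ← map_mul, added₁₂, PathAlgebra.vertex_mul_arrow]

theorem added₁₂_mul_h₁ {a : V₁} {b : V₂} (e : E₁₂ a b) :
    G.g (added₁₂ k e) * G.h₁ (f₁ (PathAlgebra.vertex a)) = G.g (added₁₂ k e) := by
  rw [h₁_comp, map₁_vertex, ← map_mul, added₁₂, PathAlgebra.arrow_mul_vertex]

theorem h₁_mul_added₂₁ {b : V₂} {a : V₁} (e : E₂₁ b a) :
    G.h₁ (f₁ (PathAlgebra.vertex a)) * G.g (added₂₁ k e) = G.g (added₂₁ k e) := by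
  rw [h₁_comp, map₁_vertex, ← map_mul, added₂₁, PathAlgebra.vertex_mul_arrow]

theorem added₂₁_mul_h₂ {b : V₂} {a : V₁} (e : E₂₁ b a) :
    G.g (added₂₁ k e) * G.h₂ (f₂ (PathAlgebra.vertex b)) = G.g (added₂₁ k e) := by
  rw [h₂_comp, map₂_vertex, ← map_mul, added₂₁, PathAlgebra.arrow_mul_vertex]

variable {S₁ : Set (Arrow (ModuleCat.{u} (PathAlgebra k V₁)))}
  {S₂ : Set (Arrow (ModuleCat.{u} (PathAlgebra k V₂)))}

/-- A homomorphism that extends over the two localisations inverts the joined set of maps, as its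
restrictions to the two path algebras factor through the localisations. -/
theorem isInverting (hf₁ : IsUniversalLocalisation S₁ (f₁ : PathAlgebra k V₁ →+* M₁))
    (hf₂ : IsUniversalLocalisation S₂ (f₂ : PathAlgebra k V₂ →+* M₂)) :
    IsInverting (joinedSet E₁₂ E₂₁ S₁ S₂)
      (G.g : PathAlgebra k (JoinQuiver E₁₂ E₂₁) →+* B) := by
  have h₁ : ((G.g : PathAlgebra k (JoinQuiver E₁₂ E₂₁) →+* B) : _ →ₙ+* B).comp (map₁ k E₁₂ E₂₁)
      = (G.h₁ : M₁ →ₙ+* B).comp ((f₁ : PathAlgebra k V₁ →+* M₁) : _ →ₙ+* M₁) :=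
    NonUnitalRingHom.ext fun x => (G.h₁_comp x).symm
  have h₂ : ((G.g : PathAlgebra k (JoinQuiver E₁₂ E₂₁) →+* B) : _ →ₙ+* B).comp (map₂ k E₁₂ E₂₁)
      = (G.h₂ : M₂ →ₙ+* B).comp ((f₂ : PathAlgebra k V₂ →+* M₂) : _ →ₙ+* M₂) :=
    NonUnitalRingHom.ext fun x => (G.h₂_comp x).symm
  rintro σ (hσ | hσ)
  · refine (isInverting_inducedSet_iff _ S₁ _).2 ?_ σ hσ
    rw [h₁]
    exact hf₁.comp_inverting _
  · refine (isInverting_inducedSet_iff _ S₂ _).2 ?_ σ hσ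
    rw [h₂]
    exact hf₂.comp_inverting _

/-- A homomorphism that inverts the joined set of maps extends over the two localisations. -/
theorem exists_of_isInverting (hf₁ : IsUniversalLocalisation S₁ (f₁ : PathAlgebra k V₁ →+* M₁))
    (hf₂ : IsUniversalLocalisation S₂ (f₂ : PathAlgebra k V₂ →+* M₂))
    (g : PathAlgebra k (JoinQuiver E₁₂ E₂₁) →ₐ[k] B)
    (hg : IsInverting (joinedSet E₁₂ E₂₁ S₁ S₂)
      (g : PathAlgebra k (JoinQuiver E₁₂ E₂₁) →+* B)) :
    ∃ G : GluedHom f₁ f₂ E₁₂ E₂₁ B, G.g = g := by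
  have hg₁ : IsInverting (inducedSet (map₁ k E₁₂ E₂₁) S₁)
      (g : PathAlgebra k (JoinQuiver E₁₂ E₂₁) →+* B) := fun σ hσ => hg σ (Or.inl hσ)
  have hg₂ : IsInverting (inducedSet (map₂ k E₁₂ E₂₁) S₂)
      (g : PathAlgebra k (JoinQuiver E₁₂ E₂₁) →+* B) := fun σ hσ => hg σ (Or.inr hσ)
  obtain ⟨h₁, hh₁⟩ := hf₁.exists_nonUnitalAlgHom map₁_smul g hg₁
  obtain ⟨h₂, hh₂⟩ := hf₂.exists_nonUnitalAlgHom map₂_smul g hg₂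
  exact ⟨⟨g, h₁, h₂, hh₁, hh₂⟩, rfl⟩

/-- The universal localisation at the joined set of maps is universal among the algebras with
compatible homomorphisms from the path algebra of the joined quiver and from the two
localisations. -/
theorem exists_lift (hf₁ : IsUniversalLocalisation S₁ (f₁ : PathAlgebra k V₁ →+* M₁))
    (hf₂ : IsUniversalLocalisation S₂ (f₂ : PathAlgebra k V₂ →+* M₂))
    (hG : IsUniversalLocalisation (joinedSet E₁₂ E₂₁ S₁ S₂)
      (G.g : PathAlgebra k (JoinQuiver E₁₂ E₂₁) →+* B)) (G' : GluedHom f₁ f₂ E₁₂ E₂₁ C) :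
    ∃ r : B →ₐ[k] C, (∀ x, r (G.g x) = G'.g x) ∧ (∀ x, r (G.h₁ x) = G'.h₁ x) ∧
      (∀ x, r (G.h₂ x) = G'.h₂ x) := by
  obtain ⟨r, hr, -⟩ := hG.2 C _ (G'.isInverting hf₁ hf₂)
  have hr' : ∀ x, r (G.g x) = G'.g x := RingHom.congr_fun hr
  have h₁ : (r : B →ₙ+* C).comp (G.h₁ : M₁ →ₙ+* B) = (G'.h₁ : M₁ →ₙ+* C) := by
    refine hf₁.nonUnital_hom_ext (NonUnitalRingHom.ext fun x => ?_)
    change r (G.h₁ (f₁ x)) = G'.h₁ (f₁ x)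
    rw [h₁_comp, h₁_comp, hr']
  have h₂ : (r : B →ₙ+* C).comp (G.h₂ : M₂ →ₙ+* B) = (G'.h₂ : M₂ →ₙ+* C) := by
    refine hf₂.nonUnital_hom_ext (NonUnitalRingHom.ext fun x => ?_)
    change r (G.h₂ (f₂ x)) = G'.h₂ (f₂ x)
    rw [h₂_comp, h₂_comp, hr']
  refine ⟨{ r with commutes' := fun c => ?_ }, hr', DFunLike.congr_fun h₁, DFunLike.congr_fun h₂⟩
  change r (algebraMap k B c) = algebraMap k C c
  rw [← G.g.commutes, hr', G'.g.commutes]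

/-- The universal localisation at the joined set of maps is generated by the images of the path
algebra of the joined quiver and of the two localisations. -/
theorem subalgebra_eq_top (hf₁ : IsUniversalLocalisation S₁ (f₁ : PathAlgebra k V₁ →+* M₁))
    (hf₂ : IsUniversalLocalisation S₂ (f₂ : PathAlgebra k V₂ →+* M₂))
    (hG : IsUniversalLocalisation (joinedSet E₁₂ E₂₁ S₁ S₂)
      (G.g : PathAlgebra k (JoinQuiver E₁₂ E₂₁) →+* B)) (s : Subalgebra k B)
    (h₁ : ∀ x, G.h₁ x ∈ s) (h₂ : ∀ x, G.h₂ x ∈ s)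
    (h₁₂ : ∀ {a b} (e : E₁₂ a b), G.g (added₁₂ k e) ∈ s)
    (h₂₁ : ∀ {b a} (e : E₂₁ b a), G.g (added₂₁ k e) ∈ s) (b : B) : b ∈ s := by
  have hg : ∀ x, G.g x ∈ s := mem_subalgebra (s := s.comap G.g)
    (fun x => by rw [Subalgebra.mem_comap, ← h₁_comp]; exact h₁ _)
    (fun x => by rw [Subalgebra.mem_comap, ← h₂_comp]; exact h₂ _) h₁₂ h₂₁
  let G' : GluedHom f₁ f₂ E₁₂ E₂₁ s :=
    { g := G.g.codRestrict s hg
      h₁ :=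
        { toFun := fun x => ⟨G.h₁ x, h₁ x⟩
          map_smul' := fun c x => Subtype.ext (map_smul G.h₁ c x)
          map_zero' := Subtype.ext (map_zero G.h₁)
          map_add' := fun x y => Subtype.ext (map_add G.h₁ x y)
          map_mul' := fun x y => Subtype.ext (map_mul G.h₁ x y) }
      h₂ :=
        { toFun := fun x => ⟨G.h₂ x, h₂ x⟩
          map_smul' := fun c x => Subtype.ext (map_smul G.h₂ c x)
          map_zero' := Subtype.ext (map_zero G.h₂)
          map_add' := fun x y => Subtype.ext (map_add G.h₂ x y)
          map_mul' := fun x y => Subtype.ext (map_mul G.h₂ x y) }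
      h₁_comp := fun x => Subtype.ext (G.h₁_comp x)
      h₂_comp := fun x => Subtype.ext (G.h₂_comp x) }
  obtain ⟨r, hr, -⟩ := G.exists_lift hf₁ hf₂ hG G'
  have : ((s.val.comp r : B →ₐ[k] B) : B →+* B) = RingHom.id B :=
    hG.ringHom_ext (RingHom.ext fun x => congrArg Subtype.val (hr x))
  have hb : ((r b : s) : B) = b := RingHom.congr_fun this b
  exact hb ▸ (r b).2

/-- A glued homomorphism is given by two homomorphisms to complementary corners of `C`, and by
elements of `C` for the added arrows. -/
theorem exists_of_added (h₁ : M₁ →ₙₐ[k] C) (h₂ : M₂ →ₙₐ[k] C) (h_add : h₁ 1 + h₂ 1 = 1)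
    (h₁₂ : ∀ x y, h₁ x * h₂ y = 0) (h₂₁ : ∀ x y, h₂ x * h₁ y = 0)
    (y₁₂ : ∀ {a : V₁} {b : V₂}, E₁₂ a b → C) (y₂₁ : ∀ {b : V₂} {a : V₁}, E₂₁ b a → C)
    (hy₁₂ : ∀ {a b} (e : E₁₂ a b), h₂ (f₂ (PathAlgebra.vertex b)) * y₁₂ e = y₁₂ e)
    (hy₁₂' : ∀ {a b} (e : E₁₂ a b), y₁₂ e * h₁ (f₁ (PathAlgebra.vertex a)) = y₁₂ e)
    (hy₂₁ : ∀ {b a} (e : E₂₁ b a), h₁ (f₁ (PathAlgebra.vertex a)) * y₂₁ e = y₂₁ e)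
    (hy₂₁' : ∀ {b a} (e : E₂₁ b a), y₂₁ e * h₂ (f₂ (PathAlgebra.vertex b)) = y₂₁ e) :
    ∃ G : GluedHom f₁ f₂ E₁₂ E₂₁ C, G.h₁ = h₁ ∧ G.h₂ = h₂ ∧
      (∀ {a b} (e : E₁₂ a b), G.g (added₁₂ k e) = y₁₂ e) ∧
      (∀ {b a} (e : E₂₁ b a), G.g (added₂₁ k e) = y₂₁ e) := by
  let e : JoinQuiver E₁₂ E₂₁ → C :=
    Sum.elim (fun v => h₁ (f₁ (PathAlgebra.vertex v))) (fun v => h₂ (f₂ (PathAlgebra.vertex v)))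
  let x : ∀ {s t : JoinQuiver E₁₂ E₂₁}, (s ⟶ t) → C := fun {s t} a =>
    match s, t, a with
    | _, _, JoinArrow.old₁ a => h₁ (f₁ (PathAlgebra.arrow a))
    | _, _, JoinArrow.old₂ a => h₂ (f₂ (PathAlgebra.arrow a))
    | _, _, JoinArrow.new₁₂ a => y₁₂ a
    | _, _, JoinArrow.new₂₁ a => y₂₁ a
  let g : PathAlgebra k (JoinQuiver E₁₂ E₂₁) →ₐ[k] C := PathAlgebra.lift e x
    (by
      rintro (v | v)
      · exact (map_mul h₁ _ _).symm.trans (by rw [← map_mul, PathAlgebra.vertex_mul_self]; rfl)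
      · exact (map_mul h₂ _ _).symm.trans (by rw [← map_mul, PathAlgebra.vertex_mul_self]; rfl))
    (by
      rintro (v | v) (w | w) hvw
      · have : v ≠ w := fun h => hvw (h ▸ rfl)
        refine (map_mul h₁ _ _).symm.trans ?_
        rw [← map_mul, PathAlgebra.vertex_mul_vertex_of_ne this, map_zero, map_zero]
      · exact h₁₂ _ _
      · exact h₂₁ _ _
      · have : v ≠ w := fun h => hvw (h ▸ rfl)
        refine (map_mul h₂ _ _).symm.trans ?_
        rw [← map_mul, PathAlgebra.vertex_mul_vertex_of_ne this, map_zero, map_zero])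
    (by
      refine (Fintype.sum_sum_type _).trans ?_
      rw [← h_add, ← map_one f₁, ← map_one f₂, PathAlgebra.one_def, PathAlgebra.one_def]
      simp only [map_sum]
      rfl)
    (by
      rintro s t (a | a | a | a)
      · refine (map_mul h₁ _ _).symm.trans ?_
        rw [← map_mul, PathAlgebra.vertex_mul_arrow]
      · refine (map_mul h₂ _ _).symm.trans ?_
        rw [← map_mul, PathAlgebra.vertex_mul_arrow]
      · exact hy₁₂ a
      · exact hy₂₁ a)
  have hg_vertex : ∀ v, g (PathAlgebra.vertex v) = e v := PathAlgebra.lift_vertex _ _ _ _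
  have hg_arrow : ∀ {s t} (a : s ⟶ t), g (PathAlgebra.arrow a) = x a := fun {s t} a => by
    refine PathAlgebra.lift_arrow _ _ _ _ a ?_
    rcases a with a | a | a | a
    · refine (map_mul h₁ _ _).symm.trans ?_
      rw [← map_mul, PathAlgebra.arrow_mul_vertex]
    · refine (map_mul h₂ _ _).symm.trans ?_
      rw [← map_mul, PathAlgebra.arrow_mul_vertex]
    · exact hy₁₂' a
    · exact hy₂₁' a
  refine ⟨⟨g, h₁, h₂, fun y => ?_, fun y => ?_⟩, rfl, rfl, fun e => hg_arrow _,
    fun e => hg_arrow _⟩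
  · induction y using PathAlgebra.induction_arrow with
    | zero => simp only [map_zero]
    | add y z hy hz => simp only [map_add, hy, hz]
    | smul c y hy => rw [map₁_smul, map_smul, map_smul, map_smul, hy]
    | vertex v => rw [map₁_vertex, hg_vertex]; rfl
    | arrow_mul e y hy => rw [map_mul, map_mul, map_mul, map_mul, hy, map₁_arrow, hg_arrow]; rfl
  · induction y using PathAlgebra.induction_arrow with
    | zero => simp only [map_zero]
    | add y z hy hz => simp only [map_add, hy, hz]
    | smul c y hy => rw [map₂_smul, map_smul, map_smul, map_smul, hy]
    | vertex v => rw [map₂_vertex, hg_vertex]; rfl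
    | arrow_mul e y hy => rw [map_mul, map_mul, map_mul, map_mul, hy, map₂_arrow, hg_arrow]; rfl

end GluedHom

end Gluing

/-! ### Path products generate the localisation -/

section Equivalence

variable {k V₁ V₂ : Type u} [Field k] [Quiver.{u} V₁] [Fintype V₁] [Quiver.{u} V₂] [Fintype V₂]
  {m₁ m₂ n₁ n₂ : ℕ}

/-- For every vertex `v`, a factorization of the idempotent matrix `f(e_v)` through the free module
of rank `dimVector f v`: dual families `γ v` and `δ v` of matrices supported in the column,
respectively the row, of index `o`. -/
structure DualFamilies {V : Type u} [Quiver.{u} V] [Fintype V] {m n : ℕ}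
    (f : PathAlgebra k V →ₐ[k] FreeMatrix k m n) (o : Fin m) where
  γ : ∀ v, Fin (dimVector f v) → FreeMatrix k m n
  δ : ∀ v, Fin (dimVector f v) → FreeMatrix k m n
  sum_γ_mul_δ : ∀ v, ∑ i, γ v i * δ v i = f (PathAlgebra.vertex v)
  δ_mul_γ : ∀ v i j, δ v i * γ v j = if i = j then Matrix.single o o 1 else 0
  γ_mul_single : ∀ v i, γ v i * Matrix.single o o 1 = γ v i
  single_mul_δ : ∀ v i, Matrix.single o o 1 * δ v i = δ v i

theorem DualFamilies.nonempty {V : Type u} [Quiver.{u} V] [Fintype V] {m n : ℕ}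
    (f : PathAlgebra k V →ₐ[k] FreeMatrix k m n) (o : Fin m) : Nonempty (DualFamilies f o) := by
  choose γ δ h₁ h₂ h₃ h₄ using exists_dual_families_vertex f o
  exact ⟨⟨γ, δ, h₁, h₂, h₃, h₄⟩⟩

theorem DualFamilies.vertex_mul_γ {V : Type u} [Quiver.{u} V] [Fintype V] {m n : ℕ}
    {f : PathAlgebra k V →ₐ[k] FreeMatrix k m n} {o : Fin m} (D : DualFamilies f o) (v : V)
    (j : Fin (dimVector f v)) :
    f (PathAlgebra.vertex v) * D.γ v j = D.γ v j := by
  rw [← D.sum_γ_mul_δ, Finset.sum_mul, Finset.sum_eq_single j]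
  · rw [mul_assoc, D.δ_mul_γ, if_pos rfl, D.γ_mul_single]
  · intro i _ h
    rw [mul_assoc, D.δ_mul_γ, if_neg h, mul_zero]
  · simp

theorem DualFamilies.δ_mul_vertex {V : Type u} [Quiver.{u} V] [Fintype V] {m n : ℕ}
    {f : PathAlgebra k V →ₐ[k] FreeMatrix k m n} {o : Fin m} (D : DualFamilies f o) (v : V)
    (j : Fin (dimVector f v)) :
    D.δ v j * f (PathAlgebra.vertex v) = D.δ v j := by
  rw [← D.sum_γ_mul_δ, Finset.mul_sum, Finset.sum_eq_single j]
  · rw [← mul_assoc, D.δ_mul_γ, if_pos rfl, D.single_mul_δ]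
  · intro i _ h
    rw [← mul_assoc, D.δ_mul_γ, if_neg h.symm, zero_mul]
  · simp

/-- If the idempotent matrix unit of index `o` and the loops are chosen elements, then all elements
of the corner of the matrix ring at `o` are combinations of path products. -/
theorem PeirceData.Gen.matrix {B : Type u} [Ring B] [Algebra k B] {W : Type*} [Quiver.{u} W]
    {D : PeirceData B W} {m n : ℕ} {h : FreeMatrix k m n →ₙₐ[k] B} {w : W} {o : Fin m}
    (he : Gen k D w w (h (Matrix.single o o 1)))
    (hx : ∀ i, Gen k D w w (h (Matrix.single o o (FreeAlgebra.ι k i))))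
    {x : FreeMatrix k m n} (hox : Matrix.single o o 1 * x = x) (hxo : x * Matrix.single o o 1 = x) :
    Gen k D w w (h x) := by
  have key : ∀ r : FreeAlgebra k (Fin n), Gen k D w w (h (Matrix.single o o r)) := by
    intro r
    induction r using FreeAlgebra.induction with
    | grade0 c =>
      rw [Algebra.algebraMap_eq_smul_one, ← Matrix.smul_single, map_smul]
      exact he.smul c
    | grade1 i => exact hx i
    | mul a b ha hb =>
      have : Matrix.single o o (a * b) = Matrix.single o o a * Matrix.single o o b := by simp
      rw [this, map_mul]
      exact ha.mul hb
    | add a b ha hb =>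
      rw [Matrix.single_add, map_add]
      exact ha.add hb
  have : x = Matrix.single o o (x o o) := by
    conv_lhs => rw [← hox, ← hxo, ← mul_assoc, Matrix.single_mul_mul_single]
    simp
  rw [this]
  exact key _

namespace GluedHom

variable {f₁ : PathAlgebra k V₁ →ₐ[k] FreeMatrix k m₁ n₁}
  {f₂ : PathAlgebra k V₂ →ₐ[k] FreeMatrix k m₂ n₂} {E₁₂ : V₁ → V₂ → Type u}
  {E₂₁ : V₂ → V₁ → Type u} {B : Type u} [Ring B] [Algebra k B] (G : GluedHom f₁ f₂ E₁₂ E₂₁ B)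
  {o₁ : Fin m₁} {o₂ : Fin m₂} (D₁ : DualFamilies f₁ o₁) (D₂ : DualFamilies f₂ o₂)

open JoinQuiver

/-- The idempotents of `B` for the two vertices of the quiver with two vertices. -/
def peirceIdem (G : GluedHom f₁ f₂ E₁₂ E₂₁ B) (o₁ : Fin m₁) (o₂ : Fin m₂) : TwoVertex → B
  | .v₁ => G.h₁ (Matrix.single o₁ o₁ 1)
  | .v₂ => G.h₂ (Matrix.single o₂ o₂ 1)

/-- The elements of `B` for the arrows of the quiver with two vertices: a loop acts through the
variable it stands for, and the arrows that come from an added arrow `e` are the matrix coefficients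
of the action of `e` with respect to the dual families at its source and at its target. -/
def peirceArrow : ∀ {s t : TwoVertex},
    TwoVertexArrow E₁₂ E₂₁ n₁ n₂ (dimVector f₁) (dimVector f₂) s t → B
  | _, _, .loop₁ i => G.h₁ (Matrix.single o₁ o₁ (FreeAlgebra.ι k i))
  | _, _, .loop₂ i => G.h₂ (Matrix.single o₂ o₂ (FreeAlgebra.ι k i))
  | _, _, .arrow₁₂ a b e i j => G.h₂ (D₂.δ b j) * G.g (added₁₂ k e) * G.h₁ (D₁.γ a i)
  | _, _, .arrow₂₁ b a e j i => G.h₁ (D₁.δ a i) * G.g (added₂₁ k e) * G.h₂ (D₂.γ b j)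

/-- The idempotents and arrow elements of `B` through which `B`-modules become representations of
the quiver with two vertices. -/
def peirceData :
    PeirceData B (TwoVertexQuiver E₁₂ E₂₁ n₁ n₂ (dimVector f₁) (dimVector f₂)) where
  e := G.peirceIdem o₁ o₂
  x := G.peirceArrow D₁ D₂
  e_mul_e := by
    rintro (_ | _)
    · exact (map_mul G.h₁ _ _).symm.trans (by simp [peirceIdem])
    · exact (map_mul G.h₂ _ _).symm.trans (by simp [peirceIdem])
  e_mul_x := by
    rintro _ _ (i | i | ⟨a, b, e, i, j⟩ | ⟨b, a, e, j, i⟩)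
    · exact (map_mul G.h₁ _ _).symm.trans (by simp [peirceArrow])
    · exact (map_mul G.h₂ _ _).symm.trans (by simp [peirceArrow])
    · simp only [peirceArrow, peirceIdem, ← mul_assoc]
      rw [← map_mul, D₂.single_mul_δ]
    · simp only [peirceArrow, peirceIdem, ← mul_assoc]
      rw [← map_mul, D₁.single_mul_δ]
  x_mul_e := by
    rintro _ _ (i | i | ⟨a, b, e, i, j⟩ | ⟨b, a, e, j, i⟩)
    · exact (map_mul G.h₁ _ _).symm.trans (by simp [peirceArrow])
    · exact (map_mul G.h₂ _ _).symm.trans (by simp [peirceArrow])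
    · simp only [peirceArrow, peirceIdem, mul_assoc]
      rw [← map_mul, D₁.γ_mul_single]
    · simp only [peirceArrow, peirceIdem, mul_assoc]
      rw [← map_mul, D₂.γ_mul_single]

theorem gen_h₁ {x : FreeMatrix k m₁ n₁} (hox : Matrix.single o₁ o₁ 1 * x = x)
    (hxo : x * Matrix.single o₁ o₁ 1 = x) :
    PeirceData.Gen k (G.peirceData D₁ D₂) TwoVertex.v₁ TwoVertex.v₁ (G.h₁ x) :=
  PeirceData.Gen.matrix (PeirceData.Gen.e (D := G.peirceData D₁ D₂) TwoVertex.v₁)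
    (fun i => PeirceData.Gen.x (D := G.peirceData D₁ D₂) (TwoVertexArrow.loop₁ i)) hox hxo

theorem gen_h₂ {x : FreeMatrix k m₂ n₂} (hox : Matrix.single o₂ o₂ 1 * x = x)
    (hxo : x * Matrix.single o₂ o₂ 1 = x) :
    PeirceData.Gen k (G.peirceData D₁ D₂) TwoVertex.v₂ TwoVertex.v₂ (G.h₂ x) :=
  PeirceData.Gen.matrix (PeirceData.Gen.e (D := G.peirceData D₁ D₂) TwoVertex.v₂)
    (fun i => PeirceData.Gen.x (D := G.peirceData D₁ D₂) (TwoVertexArrow.loop₂ i)) hox hxo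

/-- An added arrow `e` acts through the rank factorizations of the idempotents at its two ends, so
all its matrix coefficients are combinations of those with respect to the dual families. -/
theorem gen_added₁₂ {a : V₁} {b : V₂} (e : E₁₂ a b) {x : FreeMatrix k m₂ n₂}
    {y : FreeMatrix k m₁ n₁} (hx : Matrix.single o₂ o₂ 1 * x = x)
    (hy : y * Matrix.single o₁ o₁ 1 = y) :
    PeirceData.Gen k (G.peirceData D₁ D₂) TwoVertex.v₁ TwoVertex.v₂
      (G.h₂ x * G.g (added₁₂ k e) * G.h₁ y) := by
  have h : G.h₂ x * G.g (added₁₂ k e) * G.h₁ y = ∑ j, ∑ i, G.h₂ (x * D₂.γ b j) *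
      (G.h₂ (D₂.δ b j) * G.g (added₁₂ k e) * G.h₁ (D₁.γ a i)) * G.h₁ (D₁.δ a i * y) := by
    have he : G.g (added₁₂ k e) = G.h₂ (f₂ (PathAlgebra.vertex b)) *
        G.g (added₁₂ k e) * G.h₁ (f₁ (PathAlgebra.vertex a)) := by
      rw [h₂_mul_added₁₂, added₁₂_mul_h₁]
    conv_lhs => rw [he, ← D₁.sum_γ_mul_δ, ← D₂.sum_γ_mul_δ]
    simp only [map_sum, map_mul, Finset.mul_sum, Finset.sum_mul, mul_assoc]
    rw [Finset.sum_comm]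
  rw [h]
  refine PeirceData.Gen.sum _ _ _ fun j _ => PeirceData.Gen.sum _ _ _ fun i _ => ?_
  refine ((G.gen_h₂ D₁ D₂ ?_ ?_).mul
    (PeirceData.Gen.x (D := G.peirceData D₁ D₂) (TwoVertexArrow.arrow₁₂ a b e i j))).mul
    (G.gen_h₁ D₁ D₂ ?_ ?_)
  · rw [← mul_assoc, hx]
  · rw [mul_assoc, D₂.γ_mul_single]
  · rw [← mul_assoc, D₁.single_mul_δ]
  · rw [mul_assoc, hy]

theorem gen_added₂₁ {b : V₂} {a : V₁} (e : E₂₁ b a) {x : FreeMatrix k m₁ n₁}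
    {y : FreeMatrix k m₂ n₂} (hx : Matrix.single o₁ o₁ 1 * x = x)
    (hy : y * Matrix.single o₂ o₂ 1 = y) :
    PeirceData.Gen k (G.peirceData D₁ D₂) TwoVertex.v₂ TwoVertex.v₁
      (G.h₁ x * G.g (added₂₁ k e) * G.h₂ y) := by
  have h : G.h₁ x * G.g (added₂₁ k e) * G.h₂ y = ∑ i, ∑ j, G.h₁ (x * D₁.γ a i) *
      (G.h₁ (D₁.δ a i) * G.g (added₂₁ k e) * G.h₂ (D₂.γ b j)) * G.h₂ (D₂.δ b j * y) := by
    have he : G.g (added₂₁ k e) = G.h₁ (f₁ (PathAlgebra.vertex a)) *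
        G.g (added₂₁ k e) * G.h₂ (f₂ (PathAlgebra.vertex b)) := by
      rw [h₁_mul_added₂₁, added₂₁_mul_h₂]
    conv_lhs => rw [he, ← D₁.sum_γ_mul_δ, ← D₂.sum_γ_mul_δ]
    simp only [map_sum, map_mul, Finset.mul_sum, Finset.sum_mul, mul_assoc]
    rw [Finset.sum_comm]
  rw [h]
  refine PeirceData.Gen.sum _ _ _ fun i _ => PeirceData.Gen.sum _ _ _ fun j _ => ?_
  refine ((G.gen_h₁ D₁ D₂ ?_ ?_).mul
    (PeirceData.Gen.x (D := G.peirceData D₁ D₂) (TwoVertexArrow.arrow₂₁ b a e j i))).mul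
    (G.gen_h₂ D₁ D₂ ?_ ?_)
  · rw [← mul_assoc, hx]
  · rw [mul_assoc, D₁.γ_mul_single]
  · rw [← mul_assoc, D₂.single_mul_δ]
  · rw [mul_assoc, hy]

/-- The vertex of the quiver with two vertices to which a row index of one of the two matrix rings
belongs. -/
def side : Fin m₁ ⊕ Fin m₂ → TwoVertex := Sum.elim (fun _ => .v₁) (fun _ => .v₂)

/-- The matrix units in the columns of index `o₁` and `o₂`. -/
def colUnit (G : GluedHom f₁ f₂ E₁₂ E₂₁ B) (o₁ : Fin m₁) (o₂ : Fin m₂) : Fin m₁ ⊕ Fin m₂ → B :=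
  Sum.elim (fun p => G.h₁ (Matrix.single p o₁ 1)) (fun p => G.h₂ (Matrix.single p o₂ 1))

/-- The matrix units in the rows of index `o₁` and `o₂`. -/
def rowUnit (G : GluedHom f₁ f₂ E₁₂ E₂₁ B) (o₁ : Fin m₁) (o₂ : Fin m₂) : Fin m₁ ⊕ Fin m₂ → B :=
  Sum.elim (fun p => G.h₁ (Matrix.single o₁ p 1)) (fun p => G.h₂ (Matrix.single o₂ p 1))

theorem sum_colUnit_mul_rowUnit : ∑ j, G.colUnit o₁ o₂ j * G.rowUnit o₁ o₂ j = 1 := by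
  rw [Fintype.sum_sum_type, ← G.h₁_one_add_h₂_one, ← Matrix.sum_single_one, ← Matrix.sum_single_one]
  simp [colUnit, rowUnit, ← map_mul]

theorem idem_mul_rowUnit (j : Fin m₁ ⊕ Fin m₂) :
    G.peirceIdem o₁ o₂ (side j) * G.rowUnit o₁ o₂ j = G.rowUnit o₁ o₂ j := by
  rcases j with p | p <;> simp [side, peirceIdem, rowUnit, ← map_mul]

theorem gen_rowUnit_mul_idem (w : TwoVertex) (j : Fin m₁ ⊕ Fin m₂) :
    PeirceData.Gen k (G.peirceData D₁ D₂) w (side j)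
      (G.rowUnit o₁ o₂ j * G.peirceIdem o₁ o₂ w) := by
  rcases w with _ | _ <;> rcases j with p | p
  · refine (map_mul G.h₁ _ _).symm ▸ G.gen_h₁ D₁ D₂ ?_ ?_
    · simp [← mul_assoc]
    · simp [mul_assoc]
  · exact (G.h₂_mul_h₁ _ _).symm ▸ PeirceData.Gen.zero _ _
  · exact (G.h₁_mul_h₂ _ _).symm ▸ PeirceData.Gen.zero _ _
  · refine (map_mul G.h₂ _ _).symm ▸ G.gen_h₂ D₁ D₂ ?_ ?_
    · simp [← mul_assoc]
    · simp [mul_assoc]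

theorem gen_h₁_coeff (x : FreeMatrix k m₁ n₁) (j l : Fin m₁ ⊕ Fin m₂) :
    PeirceData.Gen k (G.peirceData D₁ D₂) (side l) (side j)
      (G.rowUnit o₁ o₂ j * G.h₁ x * G.colUnit o₁ o₂ l) := by
  rcases j with p | p
  · rcases l with q | q
    · have : G.rowUnit o₁ o₂ (.inl p) * G.h₁ x * G.colUnit o₁ o₂ (.inl q)
          = G.h₁ (Matrix.single o₁ p 1 * x * Matrix.single q o₁ 1) := by
        rw [map_mul, map_mul]
        rfl
      rw [this]
      refine G.gen_h₁ D₁ D₂ ?_ ?_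
      · simp
      · simp [mul_assoc]
    · have : G.rowUnit o₁ o₂ (.inl p) * G.h₁ x * G.colUnit o₁ o₂ (.inr q) = 0 := by
        simp [colUnit, mul_assoc, h₁_mul_h₂]
      rw [this]
      exact PeirceData.Gen.zero _ _
  · have : G.rowUnit o₁ o₂ (.inr p) * G.h₁ x = 0 := by
      simp [rowUnit, h₂_mul_h₁]
    rw [this, zero_mul]
    exact PeirceData.Gen.zero _ _

theorem gen_h₂_coeff (x : FreeMatrix k m₂ n₂) (j l : Fin m₁ ⊕ Fin m₂) :
    PeirceData.Gen k (G.peirceData D₁ D₂) (side l) (side j)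
      (G.rowUnit o₁ o₂ j * G.h₂ x * G.colUnit o₁ o₂ l) := by
  rcases j with p | p
  · have : G.rowUnit o₁ o₂ (.inl p) * G.h₂ x = 0 := by
      simp [rowUnit, h₁_mul_h₂]
    rw [this, zero_mul]
    exact PeirceData.Gen.zero _ _
  · rcases l with q | q
    · have : G.rowUnit o₁ o₂ (.inr p) * G.h₂ x * G.colUnit o₁ o₂ (.inl q) = 0 := by
        simp [colUnit, mul_assoc, h₂_mul_h₁]
      rw [this]
      exact PeirceData.Gen.zero _ _
    · have : G.rowUnit o₁ o₂ (.inr p) * G.h₂ x * G.colUnit o₁ o₂ (.inr q)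
          = G.h₂ (Matrix.single o₂ p 1 * x * Matrix.single q o₂ 1) := by
        rw [map_mul, map_mul]
        rfl
      rw [this]
      refine G.gen_h₂ D₁ D₂ ?_ ?_
      · simp
      · simp [mul_assoc]

theorem gen_added₁₂_coeff {a : V₁} {b : V₂} (e : E₁₂ a b) (j l : Fin m₁ ⊕ Fin m₂) :
    PeirceData.Gen k (G.peirceData D₁ D₂) (side l) (side j)
      (G.rowUnit o₁ o₂ j * G.g (added₁₂ k e) * G.colUnit o₁ o₂ l) := by
  rcases j with p | p
  · have : G.rowUnit o₁ o₂ (.inl p) * G.g (added₁₂ k e) = 0 := by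
      rw [← h₂_mul_added₁₂, ← mul_assoc]
      simp [rowUnit, h₁_mul_h₂]
    rw [this, zero_mul]
    exact PeirceData.Gen.zero _ _
  · rcases l with q | q
    · refine G.gen_added₁₂ D₁ D₂ e ?_ ?_ <;> simp
    · have : G.g (added₁₂ k e) * G.colUnit o₁ o₂ (.inr q) = 0 := by
        rw [← added₁₂_mul_h₁, mul_assoc]
        simp [colUnit, h₁_mul_h₂]
      rw [mul_assoc, this, mul_zero]
      exact PeirceData.Gen.zero _ _

theorem gen_added₂₁_coeff {b : V₂} {a : V₁} (e : E₂₁ b a) (j l : Fin m₁ ⊕ Fin m₂) :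
    PeirceData.Gen k (G.peirceData D₁ D₂) (side l) (side j)
      (G.rowUnit o₁ o₂ j * G.g (added₂₁ k e) * G.colUnit o₁ o₂ l) := by
  rcases j with p | p
  · rcases l with q | q
    · have : G.g (added₂₁ k e) * G.colUnit o₁ o₂ (.inl q) = 0 := by
        rw [← added₂₁_mul_h₂, mul_assoc]
        simp [colUnit, h₂_mul_h₁]
      rw [mul_assoc, this, mul_zero]
      exact PeirceData.Gen.zero _ _
    · refine G.gen_added₂₁ D₁ D₂ e ?_ ?_ <;> simp
  · have : G.rowUnit o₁ o₂ (.inr p) * G.g (added₂₁ k e) = 0 := by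
      rw [← h₁_mul_added₂₁, ← mul_assoc]
      simp [rowUnit, h₂_mul_h₁]
    rw [this, zero_mul]
    exact PeirceData.Gen.zero _ _

variable {S₁ : Set (Arrow (ModuleCat.{u} (PathAlgebra k V₁)))}
  {S₂ : Set (Arrow (ModuleCat.{u} (PathAlgebra k V₂)))}

/-- All matrix coefficients of elements of the localisation are combinations of path products, as
this holds for the generators of the localisation. -/
theorem gen_coeff
    (hf₁ : IsUniversalLocalisation S₁ (f₁ : PathAlgebra k V₁ →+* FreeMatrix k m₁ n₁))
    (hf₂ : IsUniversalLocalisation S₂ (f₂ : PathAlgebra k V₂ →+* FreeMatrix k m₂ n₂))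
    (hG : IsUniversalLocalisation (joinedSet E₁₂ E₂₁ S₁ S₂)
      (G.g : PathAlgebra k (JoinQuiver E₁₂ E₂₁) →+* B)) (b : B) (j l : Fin m₁ ⊕ Fin m₂) :
    PeirceData.Gen k (G.peirceData D₁ D₂) (side l) (side j)
      (G.rowUnit o₁ o₂ j * b * G.colUnit o₁ o₂ l) := by
  -- The unit is `h₁ 1 + h₂ 1`, so its coefficients are covered by those of the matrix rings.
  have h1 : ∀ j l, PeirceData.Gen k (G.peirceData D₁ D₂) (side l) (side j)
      (G.rowUnit o₁ o₂ j * G.colUnit o₁ o₂ l) := fun j l => by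
    have := (G.gen_h₁_coeff D₁ D₂ 1 j l).add (G.gen_h₂_coeff D₁ D₂ 1 j l)
    rwa [← add_mul, ← mul_add, h₁_one_add_h₂_one, mul_one] at this
  exact G.subalgebra_eq_top hf₁ hf₂ hG
    ((G.peirceData D₁ D₂).genSubalgebra side _ _ G.sum_colUnit_mul_rowUnit h1)
    (G.gen_h₁_coeff D₁ D₂) (G.gen_h₂_coeff D₁ D₂) (G.gen_added₁₂_coeff D₁ D₂)
    (G.gen_added₂₁_coeff D₁ D₂) b j l

end GluedHom

end Equivalence

/-! ### Modules with a given representation -/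

section EssentialSurjectivity

variable {k V₁ V₂ : Type u} [Field k] [Quiver.{u} V₁] [Fintype V₁] [Quiver.{u} V₂] [Fintype V₂]
  {m₁ m₂ n₁ n₂ : ℕ}

/-- An action of `k⟨x_1, …, x_n⟩` on `L` gives a (non-unital) action of its ring of `m × m` matrices
on every space `N` that contains `L ^ m` as a direct summand, with inclusions `ι p` and projections
`π p` of the `m` copies of `L`. -/
def matrixAction {m n : ℕ} {L N : Type*} [AddCommGroup L] [Module k L] [AddCommGroup N] [Module k N]
    (ι : Fin m → L →ₗ[k] N) (π : Fin m → N →ₗ[k] L)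
    (hπι : ∀ p q, π p ∘ₗ ι q = if p = q then LinearMap.id else 0)
    (ρ : FreeAlgebra k (Fin n) →ₐ[k] Module.End k L) : FreeMatrix k m n →ₙₐ[k] Module.End k N where
  toFun x := ∑ p, ∑ q, ι p ∘ₗ ρ (x p q) ∘ₗ π q
  map_smul' c x := by
    simp [Finset.smul_sum, LinearMap.comp_smul, LinearMap.smul_comp]
  map_zero' := by simp
  map_add' x y := by
    simp [LinearMap.comp_add, LinearMap.add_comp, Finset.sum_add_distrib]
  map_mul' x y := by
    have h : ∀ p q r s, (ι p ∘ₗ ρ (x p q) ∘ₗ π q) * (ι r ∘ₗ ρ (y r s) ∘ₗ π s)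
        = if q = r then ι p ∘ₗ ρ (x p q * y r s) ∘ₗ π s else 0 := fun p q r s => by
      have : (ι p ∘ₗ ρ (x p q) ∘ₗ π q) * (ι r ∘ₗ ρ (y r s) ∘ₗ π s)
          = ι p ∘ₗ ρ (x p q) ∘ₗ (π q ∘ₗ ι r) ∘ₗ ρ (y r s) ∘ₗ π s := rfl
      rw [this, hπι]
      split_ifs
      · rw [map_mul]
        rfl
      · simp
    have h' : ∀ p r s, (∑ q, if q = r then ι p ∘ₗ ρ (x p q * y r s) ∘ₗ π s else 0)
        = ι p ∘ₗ ρ (x p r * y r s) ∘ₗ π s := fun p r s =>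
      (Finset.sum_ite_eq' _ _ _).trans (if_pos (Finset.mem_univ r))
    have hρ : ∀ p s, ι p ∘ₗ ρ ((x * y) p s) ∘ₗ π s = ∑ r, ι p ∘ₗ ρ (x p r * y r s) ∘ₗ π s :=
      fun p s => by
        ext n
        simp [Matrix.mul_apply]
    simp only [Finset.sum_mul, Finset.mul_sum, h, h', hρ]
    exact Finset.sum_comm.trans ((Finset.sum_congr rfl fun s _ => Finset.sum_comm).trans
      Finset.sum_comm)

theorem matrixAction_single {m n : ℕ} {L N : Type*} [AddCommGroup L] [Module k L] [AddCommGroup N]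
    [Module k N] (ι : Fin m → L →ₗ[k] N) (π : Fin m → N →ₗ[k] L)
    (hπι : ∀ p q, π p ∘ₗ ι q = if p = q then LinearMap.id else 0)
    (ρ : FreeAlgebra k (Fin n) →ₐ[k] Module.End k L) (p q : Fin m) (r : FreeAlgebra k (Fin n)) :
    matrixAction ι π hπι ρ (Matrix.single p q r) = ι p ∘ₗ ρ r ∘ₗ π q := by
  change ∑ p', ∑ q', ι p' ∘ₗ ρ (Matrix.single p q r p' q') ∘ₗ π q' = _
  rw [Finset.sum_eq_single p, Finset.sum_eq_single q]
  · simp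
  · intro q' _ h
    simp [h.symm]
  · simp
  · intro p' _ h
    simp [h.symm]
  · simp

theorem matrixAction_one {m n : ℕ} {L N : Type*} [AddCommGroup L] [Module k L] [AddCommGroup N]
    [Module k N] (ι : Fin m → L →ₗ[k] N) (π : Fin m → N →ₗ[k] L)
    (hπι : ∀ p q, π p ∘ₗ ι q = if p = q then LinearMap.id else 0)
    (ρ : FreeAlgebra k (Fin n) →ₐ[k] Module.End k L) :
    matrixAction ι π hπι ρ 1 = ∑ p, ι p ∘ₗ π p := by
  rw [← Matrix.sum_single_one, map_sum]
  refine Finset.sum_congr rfl fun p _ => ?_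
  rw [matrixAction_single, map_one]
  rfl

theorem matrixAction_mul_matrixAction {m n m' n' : ℕ} {L L' N : Type*} [AddCommGroup L] [Module k L]
    [AddCommGroup L'] [Module k L'] [AddCommGroup N] [Module k N]
    (ι : Fin m → L →ₗ[k] N) (π : Fin m → N →ₗ[k] L)
    (hπι : ∀ p q, π p ∘ₗ ι q = if p = q then LinearMap.id else 0)
    (ρ : FreeAlgebra k (Fin n) →ₐ[k] Module.End k L)
    (ι' : Fin m' → L' →ₗ[k] N) (π' : Fin m' → N →ₗ[k] L')
    (hπι' : ∀ p q, π' p ∘ₗ ι' q = if p = q then LinearMap.id else 0)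
    (ρ' : FreeAlgebra k (Fin n') →ₐ[k] Module.End k L')
    (h : ∀ p q, π p ∘ₗ ι' q = 0) (x : FreeMatrix k m n) (y : FreeMatrix k m' n') :
    matrixAction ι π hπι ρ x * matrixAction ι' π' hπι' ρ' y = 0 := by
  change (∑ p, ∑ q, ι p ∘ₗ ρ (x p q) ∘ₗ π q) * (∑ p, ∑ q, ι' p ∘ₗ ρ' (y p q) ∘ₗ π' q) = 0
  simp only [Finset.sum_mul, Finset.mul_sum]
  refine Finset.sum_eq_zero fun r _ => Finset.sum_eq_zero fun s _ => Finset.sum_eq_zero fun p _ =>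
    Finset.sum_eq_zero fun q _ => ?_
  have : (ι p ∘ₗ ρ (x p q) ∘ₗ π q) * (ι' r ∘ₗ ρ' (y r s) ∘ₗ π' s)
      = ι p ∘ₗ ρ (x p q) ∘ₗ (π q ∘ₗ ι' r) ∘ₗ ρ' (y r s) ∘ₗ π' s := rfl
  rw [this, h]
  simp

theorem sum_inl_single_add_sum_inr_single {m m' : ℕ} (L L' : Type*) [AddCommGroup L] [Module k L]
    [AddCommGroup L'] [Module k L'] :
    ∑ p : Fin m, (LinearMap.inl k (Fin m → L) (Fin m' → L') ∘ₗ LinearMap.single k (fun _ => L) p) ∘ₗ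
        (LinearMap.proj p ∘ₗ LinearMap.fst k _ _)
      + ∑ p : Fin m', (LinearMap.inr k (Fin m → L) (Fin m' → L') ∘ₗ
        LinearMap.single k (fun _ => L') p) ∘ₗ (LinearMap.proj p ∘ₗ LinearMap.snd k _ _)
      = (1 : Module.End k ((Fin m → L) × (Fin m' → L'))) := by
  refine LinearMap.ext fun n => Prod.ext (funext fun p => ?_) (funext fun p => ?_)
  · simp [Prod.fst_sum]
  · simp [Prod.snd_sum]

namespace GluedHom

variable {f₁ : PathAlgebra k V₁ →ₐ[k] FreeMatrix k m₁ n₁}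
  {f₂ : PathAlgebra k V₂ →ₐ[k] FreeMatrix k m₂ n₂} {E₁₂ : V₁ → V₂ → Type u}
  {E₂₁ : V₂ → V₁ → Type u} {o₁ : Fin m₁} {o₂ : Fin m₂} (D₁ : DualFamilies f₁ o₁)
  (D₂ : DualFamilies f₂ o₂)

open JoinQuiver

/-- The element `∑ i, ∑ j, γ' j * X i j * δ i` has the coefficients `X i j` with respect to the dual
families `γ, δ` and `γ', δ'`. -/
theorem coeff_sum {V W C : Type u} [Quiver.{u} V] [Fintype V] [Quiver.{u} W] [Fintype W]
    [Ring C] [Algebra k C] {m n m' n' : ℕ} {f : PathAlgebra k V →ₐ[k] FreeMatrix k m n}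
    {f' : PathAlgebra k W →ₐ[k] FreeMatrix k m' n'} {o : Fin m} {o' : Fin m'}
    (D : DualFamilies f o) (D' : DualFamilies f' o')
    (h : FreeMatrix k m n →ₙₐ[k] C) (h' : FreeMatrix k m' n' →ₙₐ[k] C) (a : V) (b : W)
    (X : Fin (dimVector f a) → Fin (dimVector f' b) → C) (i : Fin (dimVector f a))
    (j : Fin (dimVector f' b))
    (hX : h' (Matrix.single o' o' 1) * X i j * h (Matrix.single o o 1) = X i j) :
    h' (D'.δ b j) * (∑ i, ∑ j, h' (D'.γ b j) * X i j * h (D.δ a i)) * h (D.γ a i) = X i j := by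
  have key : ∀ i' j', h' (D'.δ b j) * (h' (D'.γ b j') * X i' j' * h (D.δ a i')) * h (D.γ a i)
      = h' (D'.δ b j * D'.γ b j') * X i' j' * h (D.δ a i' * D.γ a i) := fun i' j' => by
    simp only [map_mul, mul_assoc]
  simp only [Finset.mul_sum, Finset.sum_mul, key, D.δ_mul_γ, D'.δ_mul_γ]
  rw [Finset.sum_eq_single i, Finset.sum_eq_single j]
  · simpa using hX
  · intro j' _ hj
    rw [if_neg hj.symm, map_zero, zero_mul, zero_mul]
  · simp
  · intro i' _ hi
    refine Finset.sum_eq_zero fun j' _ => ?_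
    rw [if_neg hi, map_zero, mul_zero]
  · simp

/-- Every representation `L` of the quiver with two vertices comes from a glued homomorphism to the
ring of endomorphisms of the space `N = L(v₁) ^ m₁ × L(v₂) ^ m₂`: the matrix rings act on the two
factors through the loops, and an added arrow acts by the maps that have the maps of `L` as
coefficients with respect to the dual families. -/
theorem exists_of_rep
    (L : QuiverRep k (TwoVertexQuiver E₁₂ E₂₁ n₁ n₂ (dimVector f₁) (dimVector f₂))) :
    ∃ (N : Type u) (_ : AddCommGroup N) (_ : Module k N)
      (G : GluedHom f₁ f₂ E₁₂ E₂₁ (Module.End k N))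
      (ι : ∀ w : TwoVertexQuiver E₁₂ E₂₁ n₁ n₂ (dimVector f₁) (dimVector f₂), L.obj w →ₗ[k] N)
      (π : ∀ w : TwoVertexQuiver E₁₂ E₂₁ n₁ n₂ (dimVector f₁) (dimVector f₂), N →ₗ[k] L.obj w),
      (∀ w : TwoVertexQuiver E₁₂ E₂₁ n₁ n₂ (dimVector f₁) (dimVector f₂),
        π w ∘ₗ ι w = LinearMap.id) ∧
      (∀ w : TwoVertexQuiver E₁₂ E₂₁ n₁ n₂ (dimVector f₁) (dimVector f₂),
        ι w ∘ₗ π w = (G.peirceData D₁ D₂).e w) ∧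
      ∀ {s t : TwoVertexQuiver E₁₂ E₂₁ n₁ n₂ (dimVector f₁) (dimVector f₂)} (a : s ⟶ t),
        (G.peirceData D₁ D₂).x a = ι t ∘ₗ (L.map a.toPath).hom ∘ₗ π s := by
  let w₁ : TwoVertexQuiver E₁₂ E₂₁ n₁ n₂ (dimVector f₁) (dimVector f₂) := TwoVertex.v₁
  let w₂ : TwoVertexQuiver E₁₂ E₂₁ n₁ n₂ (dimVector f₁) (dimVector f₂) := TwoVertex.v₂
  let L₁ : ModuleCat.{u} k := L.obj w₁
  let L₂ : ModuleCat.{u} k := L.obj w₂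
  let lp₁ : Fin n₁ → Module.End k L₁ := fun i =>
    (L.map (Quiver.Hom.toPath (a := w₁) (b := w₁) (TwoVertexArrow.loop₁ i))).hom
  let lp₂ : Fin n₂ → Module.End k L₂ := fun i =>
    (L.map (Quiver.Hom.toPath (a := w₂) (b := w₂) (TwoVertexArrow.loop₂ i))).hom
  let ar₁₂ : ∀ a b (e : E₁₂ a b), Fin (dimVector f₁ a) → Fin (dimVector f₂ b) → L₁ →ₗ[k] L₂ :=
    fun a b e i j =>
      (L.map (Quiver.Hom.toPath (a := w₁) (b := w₂) (TwoVertexArrow.arrow₁₂ a b e i j))).hom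
  let ar₂₁ : ∀ b a (e : E₂₁ b a), Fin (dimVector f₂ b) → Fin (dimVector f₁ a) → L₂ →ₗ[k] L₁ :=
    fun b a e j i =>
      (L.map (Quiver.Hom.toPath (a := w₂) (b := w₁) (TwoVertexArrow.arrow₂₁ b a e j i))).hom
  -- The space `N` with its inclusions and projections, and the actions of the matrix rings on it.
  let N : Type u := (Fin m₁ → L₁) × (Fin m₂ → L₂)
  let ι₁ : Fin m₁ → L₁ →ₗ[k] N := fun p =>
    LinearMap.inl k _ _ ∘ₗ LinearMap.single k (fun _ : Fin m₁ => (L₁ : Type u)) p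
  let ι₂ : Fin m₂ → L₂ →ₗ[k] N := fun p =>
    LinearMap.inr k _ _ ∘ₗ LinearMap.single k (fun _ : Fin m₂ => (L₂ : Type u)) p
  let π₁ : Fin m₁ → N →ₗ[k] L₁ := fun p => LinearMap.proj p ∘ₗ LinearMap.fst k _ _
  let π₂ : Fin m₂ → N →ₗ[k] L₂ := fun p => LinearMap.proj p ∘ₗ LinearMap.snd k _ _
  have hπι₁ : ∀ p q, π₁ p ∘ₗ ι₁ q = if p = q then LinearMap.id else 0 := fun p q => by
    ext l
    change (Pi.single q l : Fin m₁ → L₁) p = _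
    split_ifs with h
    · subst h
      simp
    · simp [h]
  have hπι₂ : ∀ p q, π₂ p ∘ₗ ι₂ q = if p = q then LinearMap.id else 0 := fun p q => by
    ext l
    change (Pi.single q l : Fin m₂ → L₂) p = _
    split_ifs with h
    · subst h
      simp
    · simp [h]
  have h₁ι₂ : ∀ p q, π₁ p ∘ₗ ι₂ q = 0 := fun p q => rfl
  have h₂ι₁ : ∀ p q, π₂ p ∘ₗ ι₁ q = 0 := fun p q => rfl
  let h₁ : FreeMatrix k m₁ n₁ →ₙₐ[k] Module.End k N :=
    matrixAction ι₁ π₁ hπι₁ (FreeAlgebra.lift k lp₁)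
  let h₂ : FreeMatrix k m₂ n₂ →ₙₐ[k] Module.End k N :=
    matrixAction ι₂ π₂ hπι₂ (FreeAlgebra.lift k lp₂)
  have hs₁ : ∀ r, h₁ (Matrix.single o₁ o₁ r) = ι₁ o₁ ∘ₗ FreeAlgebra.lift k lp₁ r ∘ₗ π₁ o₁ :=
    fun r => matrixAction_single _ _ _ _ _ _ _
  have hs₂ : ∀ r, h₂ (Matrix.single o₂ o₂ r) = ι₂ o₂ ∘ₗ FreeAlgebra.lift k lp₂ r ∘ₗ π₂ o₂ :=
    fun r => matrixAction_single _ _ _ _ _ _ _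
  have he₁ : h₁ (Matrix.single o₁ o₁ 1) = ι₁ o₁ ∘ₗ π₁ o₁ := by
    rw [hs₁, map_one]
    rfl
  have he₂ : h₂ (Matrix.single o₂ o₂ 1) = ι₂ o₂ ∘ₗ π₂ o₂ := by
    rw [hs₂, map_one]
    rfl
  have hi₁ : π₁ o₁ ∘ₗ ι₁ o₁ = LinearMap.id := (hπι₁ _ _).trans (if_pos rfl)
  have hi₂ : π₂ o₂ ∘ₗ ι₂ o₂ = LinearMap.id := (hπι₂ _ _).trans (if_pos rfl)
  have h_add : h₁ 1 + h₂ 1 = 1 := by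
    rw [matrixAction_one, matrixAction_one]
    exact sum_inl_single_add_sum_inr_single (L₁ : Type u) (L₂ : Type u)
  -- The prescribed coefficients of the added arrows, as endomorphisms of `N`.
  let X₁₂ : ∀ a b (e : E₁₂ a b), Fin (dimVector f₁ a) → Fin (dimVector f₂ b) → Module.End k N :=
    fun a b e i j => ι₂ o₂ ∘ₗ ar₁₂ a b e i j ∘ₗ π₁ o₁
  let X₂₁ : ∀ b a (e : E₂₁ b a), Fin (dimVector f₂ b) → Fin (dimVector f₁ a) → Module.End k N :=
    fun b a e j i => ι₁ o₁ ∘ₗ ar₂₁ b a e j i ∘ₗ π₂ o₂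
  have hX₁₂ : ∀ a b e i j, h₂ (Matrix.single o₂ o₂ 1) * X₁₂ a b e i j * h₁ (Matrix.single o₁ o₁ 1)
      = X₁₂ a b e i j := fun a b e i j => by
    rw [he₁, he₂]
    change ι₂ o₂ ∘ₗ (π₂ o₂ ∘ₗ ι₂ o₂) ∘ₗ ar₁₂ a b e i j ∘ₗ (π₁ o₁ ∘ₗ ι₁ o₁) ∘ₗ π₁ o₁ = _
    rw [hi₁, hi₂]
    rfl
  have hX₂₁ : ∀ b a e j i, h₁ (Matrix.single o₁ o₁ 1) * X₂₁ b a e j i * h₂ (Matrix.single o₂ o₂ 1)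
      = X₂₁ b a e j i := fun b a e j i => by
    rw [he₁, he₂]
    change ι₁ o₁ ∘ₗ (π₁ o₁ ∘ₗ ι₁ o₁) ∘ₗ ar₂₁ b a e j i ∘ₗ (π₂ o₂ ∘ₗ ι₂ o₂) ∘ₗ π₂ o₂ = _
    rw [hi₁, hi₂]
    rfl
  obtain ⟨G, hG₁, hG₂, hG₁₂, hG₂₁⟩ := exists_of_added (f₁ := f₁) (f₂ := f₂) (E₁₂ := E₁₂)
    (E₂₁ := E₂₁) h₁ h₂ h_add
    (matrixAction_mul_matrixAction ι₁ π₁ hπι₁ _ ι₂ π₂ hπι₂ _ h₁ι₂)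
    (matrixAction_mul_matrixAction ι₂ π₂ hπι₂ _ ι₁ π₁ hπι₁ _ h₂ι₁)
    (fun {a b} e => ∑ i, ∑ j, h₂ (D₂.γ b j) * X₁₂ a b e i j * h₁ (D₁.δ a i))
    (fun {b a} e => ∑ j, ∑ i, h₁ (D₁.γ a i) * X₂₁ b a e j i * h₂ (D₂.δ b j))
    (fun e => by simp only [Finset.mul_sum, ← mul_assoc, ← map_mul, D₂.vertex_mul_γ])
    (fun e => by simp only [Finset.sum_mul, mul_assoc, ← map_mul, D₁.δ_mul_vertex])
    (fun e => by simp only [Finset.mul_sum, ← mul_assoc, ← map_mul, D₁.vertex_mul_γ])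
    (fun e => by simp only [Finset.sum_mul, mul_assoc, ← map_mul, D₂.δ_mul_vertex])
  refine ⟨N, inferInstance, inferInstance, G,
    fun w => match w with
      | TwoVertex.v₁ => ι₁ o₁
      | TwoVertex.v₂ => ι₂ o₂,
    fun w => match w with
      | TwoVertex.v₁ => π₁ o₁
      | TwoVertex.v₂ => π₂ o₂, ?_, ?_, ?_⟩
  · rintro (_ | _)
    · exact hi₁
    · exact hi₂
  · rintro (_ | _)
    · exact he₁.symm.trans (hG₁ ▸ rfl)
    · exact he₂.symm.trans (hG₂ ▸ rfl)
  · rintro _ _ (i | i | ⟨a, b, e, i, j⟩ | ⟨b, a, e, j, i⟩)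
    · change G.h₁ _ = ι₁ o₁ ∘ₗ lp₁ i ∘ₗ π₁ o₁
      rw [hG₁, hs₁, FreeAlgebra.lift_ι_apply]
    · change G.h₂ _ = ι₂ o₂ ∘ₗ lp₂ i ∘ₗ π₂ o₂
      rw [hG₂, hs₂, FreeAlgebra.lift_ι_apply]
    · change G.h₂ _ * G.g _ * G.h₁ _ = X₁₂ a b e i j
      rw [hG₁, hG₂, hG₁₂]
      exact coeff_sum D₁ D₂ h₁ h₂ a b (X₁₂ a b e) i j (hX₁₂ a b e i j)
    · change G.h₁ _ * G.g _ * G.h₂ _ = X₂₁ b a e j i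
      rw [hG₁, hG₂, hG₂₁]
      exact coeff_sum D₂ D₁ h₂ h₁ b a (X₂₁ b a e) j i (hX₂₁ b a e j i)

variable {S₁ : Set (Arrow (ModuleCat.{u} (PathAlgebra k V₁)))}
  {S₂ : Set (Arrow (ModuleCat.{u} (PathAlgebra k V₂)))} {B : Type u} [Ring B] [Algebra k B]
  (G : GluedHom f₁ f₂ E₁₂ E₂₁ B)

/-- A representation yields a glued homomorphism to a ring of endomorphisms.  This extends over the
localisation `B`, and the resulting `B`-module affords the representation. -/
theorem repFunctor_essSurj
    (hf₁ : IsUniversalLocalisation S₁ (f₁ : PathAlgebra k V₁ →+* FreeMatrix k m₁ n₁))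
    (hf₂ : IsUniversalLocalisation S₂ (f₂ : PathAlgebra k V₂ →+* FreeMatrix k m₂ n₂))
    (hG : IsUniversalLocalisation (joinedSet E₁₂ E₂₁ S₁ S₂)
      (G.g : PathAlgebra k (JoinQuiver E₁₂ E₂₁) →+* B)) :
    ((G.peirceData D₁ D₂).repFunctor k).EssSurj where
  mem_essImage L := by
    obtain ⟨N, _, _, G', ι, π, hπι, hιπ, hx⟩ := exists_of_rep D₁ D₂ L
    obtain ⟨r, hr, hr₁, hr₂⟩ := G.exists_lift hf₁ hf₂ hG G'
    let _ : Module B N := Module.compHom N (r : B →+* Module.End k N)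
    have hre : ∀ w : TwoVertex, r (G.peirceIdem o₁ o₂ w) = G'.peirceIdem o₁ o₂ w := by
      rintro (_ | _)
      · exact hr₁ _
      · exact hr₂ _
    have hrx : ∀ {s t : TwoVertex}
        (a : TwoVertexArrow E₁₂ E₂₁ n₁ n₂ (dimVector f₁) (dimVector f₂) s t),
        r (G.peirceArrow D₁ D₂ a) = G'.peirceArrow D₁ D₂ a := by
      rintro _ _ (i | i | ⟨a, b, e, i, j⟩ | ⟨b, a, e, j, i⟩)
      · exact hr₁ _
      · exact hr₂ _
      · simp only [peirceArrow, map_mul, hr, hr₁, hr₂]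
      · simp only [peirceArrow, map_mul, hr, hr₁, hr₂]
    refine (PeirceData.nonempty_iso_rep (k := k) (G.peirceData D₁ D₂) (ModuleCat.of B N) L
      (fun w => (ι w).toAddMonoidHom) (fun w => π w) (fun w c l => ?_) (fun w l => ?_)
      (fun w n => ?_) (fun {s t} a l => ?_)).elim fun φ => ⟨_, ⟨φ⟩⟩
    · change ι w (c • l) = r (algebraMap k B c) (ι w l)
      rw [r.commutes, map_smul]
      rfl
    · exact LinearMap.congr_fun (hπι w) l
    · refine (LinearMap.congr_fun (hιπ w) n).trans ?_
      exact (LinearMap.congr_fun (hre w) n).symm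
    · refine (LinearMap.congr_fun (hrx a) (ι s l)).trans
        ((LinearMap.congr_fun (hx a) (ι s l)).trans ?_)
      exact congrArg (fun l => ι t ((L.map a.toPath).hom l)) (LinearMap.congr_fun (hπι s) l)

/-- Modules over the localisation are the same as representations of the quiver with two
vertices. -/
theorem repFunctor_isEquivalence
    (hf₁ : IsUniversalLocalisation S₁ (f₁ : PathAlgebra k V₁ →+* FreeMatrix k m₁ n₁))
    (hf₂ : IsUniversalLocalisation S₂ (f₂ : PathAlgebra k V₂ →+* FreeMatrix k m₂ n₂))
    (hG : IsUniversalLocalisation (joinedSet E₁₂ E₂₁ S₁ S₂)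
      (G.g : PathAlgebra k (JoinQuiver E₁₂ E₂₁) →+* B)) :
    ((G.peirceData D₁ D₂).repFunctor k).IsEquivalence where
  faithful := PeirceData.repFunctor_faithful _ side _ _ G.sum_colUnit_mul_rowUnit
    G.idem_mul_rowUnit
  full := PeirceData.repFunctor_full _ side _ _ G.sum_colUnit_mul_rowUnit
    (G.gen_rowUnit_mul_idem D₁ D₂) (G.gen_coeff D₁ D₂ hf₁ hf₂ hG)
  essSurj := G.repFunctor_essSurj D₁ D₂ hf₁ hf₂ hG

end GluedHom

end EssentialSurjectivity

theorem mainTheorem10 {k V₁ V₂ : Type u} [Field k]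
    [Quiver.{u} V₁] [Fintype V₁] [∀ a b : V₁, Finite (a ⟶ b)] (hV₁ : QuiverAcyclic V₁)
    [Quiver.{u} V₂] [Fintype V₂] [∀ a b : V₂, Finite (a ⟶ b)] (hV₂ : QuiverAcyclic V₂)
    (S₁ : Set (Arrow (ModuleCat.{u} (PathAlgebra k V₁)))) (hS₁ : BetweenFGProjectives S₁)
    (S₂ : Set (Arrow (ModuleCat.{u} (PathAlgebra k V₂)))) (hS₂ : BetweenFGProjectives S₂)
    (m₁ m₂ n₁ n₂ : ℕ) (hm₁ : 0 < m₁) (hm₂ : 0 < m₂)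
    (f₁ : PathAlgebra k V₁ →ₐ[k] FreeMatrix k m₁ n₁)
    (hf₁ : IsUniversalLocalisation S₁ (f₁ : PathAlgebra k V₁ →+* FreeMatrix k m₁ n₁))
    (f₂ : PathAlgebra k V₂ →ₐ[k] FreeMatrix k m₂ n₂)
    (hf₂ : IsUniversalLocalisation S₂ (f₂ : PathAlgebra k V₂ →+* FreeMatrix k m₂ n₂))
    (E₁₂ : V₁ → V₂ → Type u) (E₂₁ : V₂ → V₁ → Type u)
    (B : Type u) [Ring B] [Algebra k B]
    (g : PathAlgebra k (JoinQuiver E₁₂ E₂₁) →ₐ[k] B)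
    (hg : IsUniversalLocalisation (JoinQuiver.joinedSet E₁₂ E₂₁ S₁ S₂)
      (g : PathAlgebra k (JoinQuiver E₁₂ E₂₁) →+* B)) :
    ∃ F : ModuleCat.{u} B ≌
        QuiverRep k (TwoVertexQuiver E₁₂ E₂₁ n₁ n₂ (dimVector f₁) (dimVector f₂)),
      F.functor.Linear k := by
  obtain ⟨G, rfl⟩ := GluedHom.exists_of_isInverting hf₁ hf₂ g hg.1
  obtain ⟨D₁⟩ := DualFamilies.nonempty f₁ ⟨0, hm₁⟩
  obtain ⟨D₂⟩ := DualFamilies.nonempty f₂ ⟨0, hm₂⟩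
  have := G.repFunctor_isEquivalence D₁ D₂ hf₁ hf₂ hg
  let F := (G.peirceData D₁ D₂).repFunctor k
  exact ⟨F.asEquivalence, inferInstanceAs (F.Linear k)⟩

end
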